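/- Consider the following M/G/1 retrial queue. Trucks arrive at a single server according to a Poisson process of rate $\lambda>0$. Service times are independent with a common law $B$ on $[0,\infty)$, independent of the arrivals, with finite moments $\beta_1=\int t\,dB(t)$ and $\beta_2=\int t^2\,dB(t)$. A truck that arrives while the server is idle is served at once; otherwise it joins the waiting trucks. While the server is idle and $k\ge 1$ trucks are waiting, the next retrial occurs after an independent exponential time of rate $k\theta$, where $\theta>0$; unless a new truck arrives first, a uniformly chosen waiting truck then enters service. A truck leaves when its service ends. Let $\rho=\lambda\beta_1$ and assume $\rho<1$. Let $N_i$ be the number of waiting trucks just after the $i$-th service completion. Then $(N_i)$ is a Markov chain on $\{0,1,2,\dots\}$ with transition probabilities $$P_{kj}=\frac{\lambda}{\lambda+k\theta}\,q_{j-k}+\frac{k\theta}{\lambda+k\theta}\,q_{j-k+1},\qquad q_n=\int \frac{(\lambda t)^n}{n!}e^{-\lambda t}\,dB(t)\ (n\ge 0),\quad q_n=0\ (n<0).$$ This chain has exactly one stationary distribution $(\pi_k)_{k\ge0}$, and in the stationary regime the mean number of trucks is $$\overline N=\sum_{k\ge 0}k\,\pi_k=\rho+\frac{\lambda\rho}{\theta(1-\rho)}+\frac{\lambda^2\beta_2}{2(1-\rho)}.$$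 Moreover, the Markov chain that records, just after each service completion, the waiting trucks together with the time each of them has already spent in the system has a stationary law. Under every such stationary law the number of waiting trucks has distribution $(\pi_k)$, and the sojourn time (from arrival to the end of service) of the truck whose service is completed next is integrable, with mean $$\overline W=\beta_1+\frac{\lambda\beta_2}{2(1-\rho)}+\frac{\rho}{\theta(1-\rho)}.$$ -/

import Mathlib

open MeasureTheory ProbabilityTheory

noncomputable section

namespace RetrialQueue

/-! ### The embedded chain: number of waiting trucks just after each service completion -/

/-- Probability that exactly `k` trucks arrive (Poisson process of rate `lam`) during one service
whose duration has law `B`. -/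
def arrivalProb (lam : ℝ) (B : Measure ℝ) (k : ℕ) : ℝ :=
  ∫ t, (lam * t) ^ k / (k.factorial : ℝ) * Real.exp (-(lam * t)) ∂B

/-- Transition probability from `k` to `j` waiting trucks of `N' = N - δ + A`: given `N = k`,
the next truck served is a waiting one (`δ = 1`) with probability `k θ / (lam + k θ)` and a newly
arriving one (`δ = 0`) with probability `lam / (lam + k θ)`; independently, `A` trucks arrive
during the service. -/
def transProb (lam θ : ℝ) (B : Measure ℝ) (k j : ℕ) : ℝ :=
  lam / (lam + k * θ) * (if k ≤ j then arrivalProb lam B (j - k) else 0)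
    + k * θ / (lam + k * θ) * (if k ≤ j + 1 then arrivalProb lam B (j + 1 - k) else 0)

/-- `p` is a stationary distribution of the embedded chain. -/
structure IsStationaryLaw (lam θ : ℝ) (B : Measure ℝ) (p : ℕ → ℝ) : Prop where
  nonneg : ∀ k, 0 ≤ p k
  total : HasSum p 1
  invariant : ∀ j, HasSum (fun k => p k * transProb lam θ B k j) (p j)

/-! ### The queue with the individual trucks

The queue is observed at the service completions. A cycle is the time between two consecutive
service completions: an idle period of the server followed by one service. By the lack of memory of
the exponential law, the arrival and retrial clocks are drawn afresh when the idle period starts,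
and the arrival clocks once more when the service starts. -/

/-- State just after a service completion: the number `k` of waiting trucks, and the time that each
of the trucks `0, …, k - 1` has already spent in the zone (entries from `k` on carry no
information, and are set to `0` by every cycle). -/
abbrev ZoneState : Type := ℕ × (ℕ → ℝ)

/-- The random variables that drive one cycle. -/
abbrev Cycle : Type := ℝ × ℝ × ℝ × ℝ × (ℕ → ℝ)

namespace Cycle

/-- Time from the start of the idle period to the next arrival. -/
def nextArrival (ω : Cycle) : ℝ := ω.1

/-- Retrial clock of rate `θ`. -/
def retrialClock (ω : Cycle) : ℝ := ω.2.1

/-- Uniform variable in `[0, 1)` that selects one of the waiting trucks. -/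
def selector (ω : Cycle) : ℝ := ω.2.2.1

/-- Duration of the service. -/
def service (ω : Cycle) : ℝ := ω.2.2.2.1

/-- Inter-arrival times of the arrivals that follow the start of the service. -/
def gap (ω : Cycle) (n : ℕ) : ℝ := ω.2.2.2.2 n

/-- Time from the start of the service to the `(n + 1)`-st arrival after it. -/
def arrivalTime (ω : Cycle) (n : ℕ) : ℝ := ∑ i ∈ Finset.range (n + 1), ω.gap i

/-- Number of arrivals during the service: the arrivals `0, …, n - 1` occur before its end, where
`n` is the first index of an arrival after its end. -/
def arrivals (ω : Cycle) : ℕ := sInf {n | ω.service < ω.arrivalTime n}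

end Cycle

/-- The joint law of the variables of a cycle: they are independent, times to arrivals are
exponential of rate `lam`, the retrial clock is exponential of rate `θ`, and the service has
law `B`. -/
def cycleLaw (lam θ : ℝ) (B : Measure ℝ) : Measure Cycle :=
  (expMeasure lam).prod ((expMeasure θ).prod ((volume.restrict (Set.Ico (0 : ℝ) 1)).prod
    (B.prod (Measure.infinitePi fun _ : ℕ => expMeasure lam))))

/-- Time from the start of the idle period to the first retrial, when `s.1 = k ≥ 1` trucks are
waiting. It is exponential of rate `k θ`. -/
def retrialTime (s : ZoneState) (ω : Cycle) : ℝ := ω.retrialClock / s.1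

/-- The next truck served is a waiting one: a retrial precedes the next arrival. -/
def Retries (s : ZoneState) (ω : Cycle) : Prop :=
  0 < s.1 ∧ retrialTime s ω < ω.nextArrival

open Classical in
/-- Duration of the idle period. -/
def idleTime (s : ZoneState) (ω : Cycle) : ℝ :=
  if Retries s ω then retrialTime s ω else ω.nextArrival

/-- The waiting truck selected at a retrial, uniformly among `0, …, s.1 - 1`. -/
def selected (s : ZoneState) (ω : Cycle) : ℕ := ⌊ω.selector * s.1⌋₊

open Classical in
/-- Number of trucks that wait throughout the cycle. -/
def remaining (s : ZoneState) (ω : Cycle) : ℕ := if Retries s ω then s.1 - 1 else s.1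

open Classical in
/-- Index at the start of the cycle of the `i`-th truck that waits throughout the cycle. -/
def oldIndex (s : ZoneState) (ω : Cycle) (i : ℕ) : ℕ :=
  if Retries s ω ∧ selected s ω ≤ i then i + 1 else i

/-- State just after the next service completion. Trucks that wait throughout the cycle have spent
its whole duration in addition, and the trucks that arrived during the service have been in the
zone since their arrival. -/
def nextState (s : ZoneState) (ω : Cycle) : ZoneState :=
  (remaining s ω + ω.arrivals, fun i =>
    if i < remaining s ω then s.2 (oldIndex s ω i) + idleTime s ω + ω.service
    else if i < remaining s ω + ω.arrivals then ω.service - ω.arrivalTime (i - remaining s ω)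
    else 0)

open Classical in
/-- Total time spent in the zone, from arrival to the end of its loading, by the truck that leaves
at the end of the cycle. -/
def sojournTime (s : ZoneState) (ω : Cycle) : ℝ :=
  if Retries s ω then s.2 (selected s ω) + idleTime s ω + ω.service else ω.service

/-- `μ` is a stationary law of the state of the queue just after service completions. -/
structure IsStationaryZoneLaw (lam θ : ℝ) (B : Measure ℝ) (μ : Measure ZoneState) : Prop where
  isProbabilityMeasure : IsProbabilityMeasure μ
  nonneg : ∀ᵐ s ∂μ, ∀ i < s.1, 0 ≤ s.2 i
  invariant : Measure.map (fun x : ZoneState × Cycle => nextState x.1 x.2)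
    (μ.prod (cycleLaw lam θ B)) = μ

end RetrialQueue

end

open MeasureTheory ProbabilityTheory
open scoped ENNReal

noncomputable section

namespace RetrialQueue

/-! ### Exponential laws -/

/-! The whole proof rests on one principle: in a stationary regime the mean one-cycle increment of a
nonnegative functional of the state vanishes, even if the functional itself is not known to be
integrable, provided that the increment is bounded above by an integrable variable
(`integrable_sub_of_map_eq`). Write N for the number waiting, δ for the indicator of a retrial, A
for the arrivals during the service V, and I for the idle time, so that N' = N - δ + A, with A and V
independent of (N, δ).

The functional N gives E δ = ρ. The functional N² gives 2 E[N(A - δ)] + E(A - δ)² = 0; since P(δ = 1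
| N = k) = kθ/(λ + kθ), one has k P(δ = 0 | k) = (λ/θ) P(δ = 1 | k), so E[Nδ] = E N - λρ/θ and the
equation is linear in E N. That E N is finite comes first, from a truncated square (`huber`). The
total age T of the waiting trucks satisfies T' + W = T + N(I + V) + R + (1 - δ)V, where W is the
sojourn time of the departing truck and R the total age of the newcomers. Hence E W = ρ/θ + β₁ E N +
λβ₂/2 + (1 - ρ)β₁; no uniqueness of the law of the ages is needed.

The embedded chain never moves down by more than one, so the balance equations determine a
stationary law recursively from its value at 0: it is unique, and it is the marginal of every
stationary law of the zone. Existence is proved for the zone: the empty state is a single point, and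
the occupation measure of an excursion from it is invariant. Its mass, the mean return time, is
finite by a Foster criterion, so it can be normalised (`exists_lintegral_drift`,
`step_sum_excursion`). -/

theorem lintegral_expMeasure {r : ℝ} {f : ℝ → ℝ≥0∞} (hf : Measurable f) :
    ∫⁻ x, f x ∂expMeasure r
      = ∫⁻ x in Set.Ioi 0, ENNReal.ofReal (r * Real.exp (-(r * x))) * f x := by
  have hm : Measurable (exponentialPDF r) := (measurable_exponentialPDFReal r).ennreal_ofReal
  rw [show expMeasure r = volume.withDensity (exponentialPDF r) from rfl,
    lintegral_withDensity_eq_lintegral_mul _ hm hf, setLIntegral_congr Ioi_ae_eq_Ici,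
    ← lintegral_indicator measurableSet_Ici]
  refine lintegral_congr fun x => ?_
  by_cases hx : 0 ≤ x
  · rw [Set.indicator_of_mem (Set.mem_Ici.2 hx), Pi.mul_apply, exponentialPDF_of_nonneg hx]
  · rw [Set.indicator_of_notMem (by simpa using hx), Pi.mul_apply,
      exponentialPDF_of_neg (not_le.1 hx), zero_mul]

theorem ae_pos_expMeasure (r : ℝ) : ∀ᵐ x ∂expMeasure r, 0 < x := by
  have h : MeasurableSet {x : ℝ | ¬ 0 < x} := measurableSet_lt measurable_const measurable_id |>.compl
  rw [ae_iff, ← lintegral_indicator_one h, lintegral_expMeasure (measurable_one.indicator h)]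
  refine (setLIntegral_congr_fun measurableSet_Ioi fun x hx => ?_).trans lintegral_zero
  simp [Set.mem_Ioi.1 hx]

theorem lintegral_Ioi_exp_neg {r : ℝ} (hr : 0 < r) (x : ℝ) :
    ∫⁻ t in Set.Ioi x, ENNReal.ofReal (Real.exp (-(r * t)))
      = ENNReal.ofReal (Real.exp (-(r * x)) / r) := by
  have h1 := integral_exp_mul_Ioi (neg_neg_of_pos hr) x
  have h2 := integrableOn_exp_mul_Ioi (neg_neg_of_pos hr) x
  simp only [neg_mul] at h1 h2
  rw [← ofReal_integral_eq_lintegral_ofReal h2 (ae_of_all _ fun t => (Real.exp_pos _).le), h1]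
  congr 1
  ring

theorem expMeasure_Ioi {r : ℝ} (hr : 0 < r) {x : ℝ} (hx : 0 ≤ x) :
    expMeasure r (Set.Ioi x) = ENNReal.ofReal (Real.exp (-(r * x))) := by
  rw [← lintegral_indicator_one measurableSet_Ioi,
    lintegral_expMeasure (measurable_one.indicator measurableSet_Ioi)]
  have : ∀ t, ENNReal.ofReal (r * Real.exp (-(r * t))) * (Set.Ioi x).indicator 1 t
      = (Set.Ioi x).indicator (fun t => ENNReal.ofReal (r * Real.exp (-(r * t)))) t := by
    intro t
    by_cases h : t ∈ Set.Ioi x <;> simp [h]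
  simp_rw [this]
  rw [lintegral_indicator measurableSet_Ioi, Measure.restrict_restrict measurableSet_Ioi,
    Set.Ioi_inter_Ioi, sup_eq_left.2 hx]
  simp_rw [ENNReal.ofReal_mul hr.le]
  rw [lintegral_const_mul _ (by fun_prop), lintegral_Ioi_exp_neg hr, ← ENNReal.ofReal_mul hr.le]
  congr 1
  field_simp

instance nullSingletonClass_expMeasure (r : ℝ) : NullSingletonClass (expMeasure r) := by
  unfold expMeasure gammaMeasure
  infer_instance

theorem expMeasure_Ici {r : ℝ} (hr : 0 < r) {x : ℝ} (hx : 0 ≤ x) :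
    expMeasure r (Set.Ici x) = ENNReal.ofReal (Real.exp (-(r * x))) := by
  rw [← expMeasure_Ioi hr hx, measure_congr Ioi_ae_eq_Ici]

/-! ### Arrival times -/

/-- The `(n + 1)`-st arrival time as a function of the inter-arrival times. -/
def partialTime (n : ℕ) (g : ℕ → ℝ) : ℝ := ∑ i ∈ Finset.range (n + 1), g i

@[fun_prop]
theorem measurable_partialTime (n : ℕ) : Measurable (partialTime n) := by
  unfold partialTime; fun_prop

theorem partialTime_succ (n : ℕ) (g : ℕ → ℝ) :
    partialTime (n + 1) g = partialTime n g + g (n + 1) := Finset.sum_range_succ _ _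

/-- The law of the inter-arrival times. -/
abbrev gapLaw (lam : ℝ) : Measure (ℕ → ℝ) := Measure.infinitePi fun _ : ℕ => expMeasure lam

/-- Density of the `(n + 1)`-st arrival time. -/
def arrivalDensity (lam : ℝ) (n : ℕ) (t : ℝ) : ℝ :=
  lam * ((lam * t) ^ n / (n.factorial : ℝ)) * Real.exp (-(lam * t))

@[fun_prop]
theorem measurable_arrivalDensity (lam : ℝ) (n : ℕ) : Measurable (arrivalDensity lam n) := by
  unfold arrivalDensity; fun_prop

/-- The arrival time uses only the gaps up to index `n`, hence is independent of the next gap. -/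
theorem map_partialTime_prod {lam : ℝ} (hlam : 0 < lam) (n : ℕ) :
    (gapLaw lam).map (fun g => (partialTime n g, g (n + 1)))
      = ((gapLaw lam).map (partialTime n)).prod (expMeasure lam) := by
  have := isProbabilityMeasure_expMeasure hlam
  have hind : iIndepFun (fun (i : ℕ) (g : ℕ → ℝ) => g i) (gapLaw lam) :=
    iIndepFun_infinitePi (P := fun _ : ℕ => expMeasure lam) (X := fun _ x => x)
      fun _ => measurable_id
  have h := hind.indepFun_finsetSum_of_notMem (fun i => measurable_pi_apply i)
    (s := Finset.range (n + 1)) (i := n + 1) (by simp)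
  have he : (∑ j ∈ Finset.range (n + 1), fun g : ℕ → ℝ => g j) = partialTime n := by
    ext g; simp [partialTime]
  rw [he] at h
  rw [(indepFun_iff_map_prod_eq_prod_map_map (by fun_prop)
    (measurable_pi_apply _).aemeasurable).1 h,
    Measure.infinitePi_map_eval]

theorem lintegral_Ioo_pow (n : ℕ) {z : ℝ} (hz : 0 ≤ z) :
    ∫⁻ x in Set.Ioo 0 z, ENNReal.ofReal (x ^ n / (n.factorial : ℝ))
      = ENNReal.ofReal (z ^ (n + 1) / ((n + 1).factorial : ℝ)) := by
  rw [setLIntegral_congr Ioo_ae_eq_Ioc, ← ofReal_integral_eq_lintegral_ofReal,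
    ← intervalIntegral.integral_of_le hz, intervalIntegral.integral_div, integral_pow]
  · congr 1
    rw [Nat.factorial_succ]
    push_cast
    field_simp
    simp
  · exact (by fun_prop : Continuous fun x : ℝ => x ^ n / (n.factorial : ℝ)).integrableOn_Ioc
  · refine (ae_restrict_iff' measurableSet_Ioc).2 (ae_of_all _ fun x hx => ?_)
    have := hx.1.le
    positivity

/-- Arrival times have Erlang laws, by induction: each new independent gap convolves the density
with an exponential one. -/
theorem lintegral_partialTime {lam : ℝ} (hlam : 0 < lam) (n : ℕ) {f : ℝ → ℝ≥0∞}
    (hf : Measurable f) :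
    ∫⁻ g, f (partialTime n g) ∂gapLaw lam
      = ∫⁻ t in Set.Ioi 0, ENNReal.ofReal (arrivalDensity lam n t) * f t := by
  have := isProbabilityMeasure_expMeasure hlam
  induction n generalizing f with
  | zero =>
    have h1 : ∀ g : ℕ → ℝ, partialTime 0 g = g 0 := fun g => by simp [partialTime]
    simp_rw [h1]
    rw [← lintegral_map (f := f) (g := fun g : ℕ → ℝ => g 0) hf (measurable_pi_apply 0),
      Measure.infinitePi_map_eval (fun _ : ℕ => expMeasure lam), lintegral_expMeasure hf]
    simp [arrivalDensity]
  | succ n ih =>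
    have h1 : ∫⁻ g, f (partialTime (n + 1) g) ∂gapLaw lam
        = ∫⁻ g, ∫⁻ y, f (partialTime n g + y) ∂expMeasure lam ∂gapLaw lam := by
      have hm : Measurable fun p : ℝ × ℝ => f (p.1 + p.2) := by fun_prop
      have h2 := lintegral_map (μ := gapLaw lam) hm
        (g := fun g => (partialTime n g, g (n + 1))) (by fun_prop)
      rw [map_partialTime_prod hlam, lintegral_prod _ hm.aemeasurable,
        lintegral_map hm.lintegral_prod_right' (measurable_partialTime n)] at h2
      simp_rw [partialTime_succ]
      exact h2.symm
    rw [h1, ih (f := fun x => ∫⁻ y, f (x + y) ∂expMeasure lam)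
      (Measurable.lintegral_prod_right' (f := fun p : ℝ × ℝ => f (p.1 + p.2)) (by fun_prop))]
    have h3 : ∀ x, ∫⁻ y, f (x + y) ∂expMeasure lam = ∫⁻ z, (Set.Ioi x).indicator
        (fun z => ENNReal.ofReal (lam * Real.exp (-(lam * (z - x)))) * f z) z := by
      intro x
      rw [lintegral_expMeasure (by fun_prop), ← lintegral_indicator measurableSet_Ioi,
        ← lintegral_sub_right_eq_self _ x]
      refine lintegral_congr fun z => ?_
      by_cases hz : x < z <;> simp [Set.indicator, hz]
    simp_rw [h3]
    rw [← lintegral_indicator measurableSet_Ioi, ← lintegral_indicator measurableSet_Ioi]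
    -- The exponentials of `x` and `z - x` combine to one of `z`. On the region 0 < x < z only a
    -- power of `x` is left to integrate after Tonelli.
    have h4 : ∀ x, (Set.Ioi (0 : ℝ)).indicator (fun x => ENNReal.ofReal (arrivalDensity lam n x) *
          ∫⁻ z, (Set.Ioi x).indicator
            (fun z => ENNReal.ofReal (lam * Real.exp (-(lam * (z - x)))) * f z) z) x
        = ∫⁻ z, {p : ℝ × ℝ | 0 < p.1 ∧ p.1 < p.2}.indicator (fun p =>
          ENNReal.ofReal (lam ^ (n + 2) * Real.exp (-(lam * p.2))) * f p.2 *
          ENNReal.ofReal (p.1 ^ n / (n.factorial : ℝ))) (x, z) := by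
      intro x
      by_cases hx : 0 < x
      · rw [Set.indicator_of_mem (Set.mem_Ioi.2 hx), ← lintegral_const_mul]
        · refine lintegral_congr fun z => ?_
          by_cases hz : x < z
          · simp only [Set.indicator, Set.mem_Ioi, hz, Set.mem_ofPred_eq, hx, and_self, if_true]
            rw [mul_right_comm, ← ENNReal.ofReal_mul (by positivity),
              ← mul_assoc (ENNReal.ofReal (arrivalDensity lam n x)),
              ← ENNReal.ofReal_mul (by unfold arrivalDensity; positivity)]
            congr 2
            rw [arrivalDensity, show -(lam * z) = -(lam * x) + -(lam * (z - x)) by ring,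
              Real.exp_add]
            ring
          · simp [Set.indicator, hz]
        · exact (by fun_prop : Measurable fun z =>
            ENNReal.ofReal (lam * Real.exp (-(lam * (z - x)))) * f z).indicator measurableSet_Ioi
      · simp [Set.indicator, hx]
    have hS : MeasurableSet {p : ℝ × ℝ | 0 < p.1 ∧ p.1 < p.2} :=
      (measurableSet_lt measurable_const measurable_fst).inter
        (measurableSet_lt measurable_fst measurable_snd)
    rw [lintegral_congr h4, lintegral_lintegral_swap]
    · refine lintegral_congr fun z => ?_
      by_cases hz : 0 < z
      · have h5 : ∀ x, {p : ℝ × ℝ | 0 < p.1 ∧ p.1 < p.2}.indicator (fun p =>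
            ENNReal.ofReal (lam ^ (n + 2) * Real.exp (-(lam * p.2))) * f p.2 *
            ENNReal.ofReal (p.1 ^ n / (n.factorial : ℝ))) (x, z) =
            (Set.Ioo 0 z).indicator (fun x =>
            ENNReal.ofReal (lam ^ (n + 2) * Real.exp (-(lam * z))) * f z *
            ENNReal.ofReal (x ^ n / (n.factorial : ℝ))) x := by
          intro x
          by_cases hx : 0 < x ∧ x < z <;> simp [Set.indicator, hx]
        rw [lintegral_congr h5, lintegral_indicator measurableSet_Ioo,
          lintegral_const_mul _ (by fun_prop), lintegral_Ioo_pow n hz.le,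
          Set.indicator_of_mem (Set.mem_Ioi.2 hz), mul_assoc, mul_comm (f z), ← mul_assoc,
          ← ENNReal.ofReal_mul (by positivity), arrivalDensity]
        congr 2
        ring
      · have h5 : ∀ x, ¬ (0 < x ∧ x < z) := fun x hx => hz (hx.1.trans hx.2)
        simp [Set.indicator, hz, h5]
    · exact ((by fun_prop : Measurable fun p : ℝ × ℝ =>
          ENNReal.ofReal (lam ^ (n + 2) * Real.exp (-(lam * p.2))) * f p.2 *
          ENNReal.ofReal (p.1 ^ n / (n.factorial : ℝ))).indicator hS).aemeasurable

/-- Campbell's formula for the arrival process. -/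
theorem lintegral_tsum_partialTime {lam : ℝ} (hlam : 0 < lam) {f : ℝ → ℝ≥0∞}
    (hf : Measurable f) :
    ∫⁻ g, ∑' n, f (partialTime n g) ∂gapLaw lam
      = ENNReal.ofReal lam * ∫⁻ t in Set.Ioi 0, f t := by
  rw [lintegral_tsum fun n => by fun_prop]
  simp_rw [lintegral_partialTime hlam _ hf]
  rw [← lintegral_tsum fun n => by fun_prop, ← lintegral_const_mul _ hf]
  refine setLIntegral_congr_fun measurableSet_Ioi fun t ht => ?_
  have ht : 0 < t := ht
  -- The Erlang densities add up to the constant `lam`, because the exponential series cancels `exp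
  -- (-(lam * t))`.
  have hs := (NormedSpace.expSeries_div_hasSum_exp (lam * t)).mul_left lam
    |>.mul_right (Real.exp (-(lam * t)))
  rw [← Real.exp_eq_exp_ℝ, mul_assoc, ← Real.exp_add, add_neg_cancel, Real.exp_zero, mul_one] at hs
  rw [ENNReal.tsum_mul_right]
  congr 1
  refine (ENNReal.ofReal_tsum_of_nonneg (fun n => ?_) hs.summable).symm.trans
    (congrArg _ hs.tsum_eq)
  positivity

/-! ### Number of arrivals during a time interval -/

/-- Number of arrivals in `[0, v]` when the inter-arrival times are `g`. -/
def arrivalCount (v : ℝ) (g : ℕ → ℝ) : ℕ := sInf {n | v < partialTime n g}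

theorem ae_gap_pos {lam : ℝ} (hlam : 0 < lam) : ∀ᵐ g ∂gapLaw lam, ∀ n, 0 < g n := by
  have := isProbabilityMeasure_expMeasure hlam
  refine ae_all_iff.2 fun n => ?_
  have h := ae_pos_expMeasure lam
  rw [← Measure.infinitePi_map_eval (fun _ : ℕ => expMeasure lam) n] at h
  exact ae_of_ae_map (measurable_pi_apply n).aemeasurable h

theorem monotone_partialTime {g : ℕ → ℝ} (hg : ∀ n, 0 < g n) :
    Monotone fun n => partialTime n g :=
  monotone_nat_of_le_succ fun n => by rw [partialTime_succ]; linarith [hg (n + 1)]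

/-- By Campbell's formula the mean number of arrivals up to `v` is finite. If no arrival time
exceeded `v`, that number would be infinite. -/
theorem ae_exists_lt_partialTime {lam : ℝ} (hlam : 0 < lam) (v : ℝ) :
    ∀ᵐ g ∂gapLaw lam, ∃ n, v < partialTime n g := by
  have h := lintegral_tsum_partialTime hlam (f := (Set.Iic v).indicator 1)
    (measurable_one.indicator measurableSet_Iic)
  have h2 : ∫⁻ t in Set.Ioi 0, (Set.Iic v).indicator (1 : ℝ → ℝ≥0∞) t ≠ ∞ := by
    rw [lintegral_indicator_one measurableSet_Iic, Measure.restrict_apply measurableSet_Iic,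
      Set.Iic_inter_Ioi]
    exact measure_Ioc_lt_top.ne
  have h3 := ae_lt_top (μ := gapLaw lam)
    (f := fun g => ∑' n, (Set.Iic v).indicator (1 : ℝ → ℝ≥0∞) (partialTime n g))
    (.tsum fun n => (measurable_one.indicator measurableSet_Iic).comp (measurable_partialTime n))
    (h ▸ ENNReal.mul_ne_top ENNReal.ofReal_ne_top h2)
  filter_upwards [h3] with g hg
  by_contra! hc
  simp [Set.indicator, hc] at hg

/-- The hypothesis matters: `sInf ∅ = 0`, so the count would also vanish if infinitely many arrivals
fell before `v`. -/
theorem arrivalCount_eq_zero_iff {v : ℝ} {g : ℕ → ℝ} (hv : ∃ n, v < partialTime n g) :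
    arrivalCount v g = 0 ↔ v < partialTime 0 g := by
  rw [arrivalCount, Nat.sInf_eq_zero, or_iff_left]
  · rfl
  · exact Set.Nonempty.ne_empty hv

theorem lt_arrivalCount_iff {v : ℝ} {g : ℕ → ℝ} (hg : ∀ n, 0 < g n)
    (hv : ∃ n, v < partialTime n g) (n : ℕ) : n < arrivalCount v g ↔ partialTime n g ≤ v := by
  constructor
  · intro h
    exact not_lt.1 fun hc => Nat.notMem_of_lt_sInf h hc
  · intro h
    by_contra! hc
    have h2 : v < partialTime (arrivalCount v g) g := Nat.sInf_mem hv
    exact absurd (h2.trans_le (monotone_partialTime hg hc)) (not_lt.2 h)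

@[fun_prop]
theorem measurable_arrivalCount : Measurable fun x : ℝ × (ℕ → ℝ) => arrivalCount x.1 x.2 := by
  refine measurable_of_Ioi fun n => ?_
  have h : (fun x : ℝ × (ℕ → ℝ) => arrivalCount x.1 x.2) ⁻¹' Set.Ioi n
      = (⋃ m, {x | x.1 < partialTime m x.2}) ∩ ⋂ m ∈ Set.Iic n, {x | x.1 < partialTime m x.2}ᶜ := by
    ext x
    simp only [Set.mem_preimage, Set.mem_Ioi, Set.mem_inter_iff, Set.mem_iUnion, Set.mem_iInter,
      Set.mem_ofPred_eq, Set.mem_compl_iff, Set.mem_Iic]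
    constructor
    · intro h
      exact ⟨Nat.nonempty_of_pos_sInf (Nat.zero_lt_of_lt h),
        fun m hm => Nat.notMem_of_lt_sInf (hm.trans_lt h)⟩
    · rintro ⟨h1, h2⟩
      by_contra! hc
      exact h2 _ hc (Nat.sInf_mem (s := {n | x.1 < partialTime n x.2}) h1)
  have hm : ∀ m, MeasurableSet {x : ℝ × (ℕ → ℝ) | x.1 < partialTime m x.2} := fun m =>
    measurableSet_lt measurable_fst (by fun_prop)
  rw [h]
  exact (MeasurableSet.iUnion hm).inter
    (MeasurableSet.biInter (Set.to_countable _) fun m _ => (hm m).compl)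

/-- The count is `n + 1` exactly when T ≤ v < T + g, with T the Erlang arrival time of index `n` and
g the independent next gap. Integrating the exponential tail of g against the density of T gives the
Poisson weight. -/
theorem gapLaw_arrivalCount_eq {lam : ℝ} (hlam : 0 < lam) {v : ℝ} (hv : 0 ≤ v) (n : ℕ) :
    gapLaw lam {g | arrivalCount v g = n}
      = ENNReal.ofReal ((lam * v) ^ n / (n.factorial : ℝ) * Real.exp (-(lam * v))) := by
  have := isProbabilityMeasure_expMeasure hlam
  cases n with
  | zero =>
    have h : {g | arrivalCount v g = 0} =ᵐ[gapLaw lam] (fun g : ℕ → ℝ => g 0) ⁻¹' Set.Ioi v := by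
      filter_upwards [ae_exists_lt_partialTime hlam v] with g hg
      refine propext ((arrivalCount_eq_zero_iff hg).trans (?_ : _ ↔ v < g 0))
      simp [partialTime]
    rw [measure_congr h, ← Measure.map_apply (measurable_pi_apply 0) measurableSet_Ioi,
      Measure.infinitePi_map_eval (fun _ : ℕ => expMeasure lam), expMeasure_Ioi hlam hv]
    simp
  | succ n =>
    let S : Set (ℝ × ℝ) := {p | p.1 ≤ v ∧ v < p.1 + p.2}
    have hS : MeasurableSet S := (measurableSet_le measurable_fst measurable_const).inter
      (measurableSet_lt measurable_const (measurable_fst.add measurable_snd))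
    have h : {g | arrivalCount v g = n + 1} =ᵐ[gapLaw lam]
        (fun g => (partialTime n g, g (n + 1))) ⁻¹' S := by
      filter_upwards [ae_exists_lt_partialTime hlam v, ae_gap_pos hlam] with g hg hp
      refine propext (?_ : arrivalCount v g = n + 1 ↔ partialTime n g ≤ v ∧ _)
      have h1 := lt_arrivalCount_iff hp hg n
      have h2 := lt_arrivalCount_iff hp hg (n + 1)
      rw [← partialTime_succ, ← h1, ← not_le (b := v), ← h2]
      omega
    have h2 : ∀ x, expMeasure lam (Prod.mk x ⁻¹' S)
        = (Set.Iic v).indicator (fun x => ENNReal.ofReal (Real.exp (-(lam * (v - x))))) x := by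
      intro x
      by_cases hx : x ≤ v
      · rw [Set.indicator_of_mem (Set.mem_Iic.2 hx), ← expMeasure_Ioi hlam (sub_nonneg.2 hx)]
        congr 1
        ext y
        simp [S, hx, sub_lt_iff_lt_add']
      · simp [S, hx]
    have hm : Measurable fun x : ℝ => ENNReal.ofReal (Real.exp (-(lam * (v - x)))) := by fun_prop
    rw [measure_congr h, ← Measure.map_apply ((measurable_partialTime n).prodMk
      (measurable_pi_apply (n + 1))) hS, map_partialTime_prod hlam,
      Measure.prod_apply hS]
    simp_rw [h2]
    rw [lintegral_map (hm.indicator measurableSet_Iic) (measurable_partialTime n),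
      lintegral_partialTime hlam n (hm.indicator measurableSet_Iic)]
    have h3 : ∀ t ∈ Set.Ioi (0 : ℝ), ENNReal.ofReal (arrivalDensity lam n t) *
          (Set.Iic v).indicator (fun x => ENNReal.ofReal (Real.exp (-(lam * (v - x))))) t
        = (Set.Iic v).indicator (fun t => ENNReal.ofReal (lam ^ (n + 1) * Real.exp (-(lam * v))) *
          ENNReal.ofReal (t ^ n / (n.factorial : ℝ))) t := by
      intro t ht
      have ht : 0 < t := ht
      by_cases hx : t ≤ v
      · simp only [Set.indicator, Set.mem_Iic, hx, if_true]
        rw [← ENNReal.ofReal_mul (by unfold arrivalDensity; positivity),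
          ← ENNReal.ofReal_mul (by positivity)]
        congr 1
        rw [arrivalDensity, show -(lam * v) = -(lam * t) + -(lam * (v - t)) by ring, Real.exp_add]
        ring
      · simp [Set.indicator, hx]
    rw [setLIntegral_congr_fun measurableSet_Ioi h3, lintegral_indicator measurableSet_Iic,
      Measure.restrict_restrict measurableSet_Iic, Set.Iic_inter_Ioi,
      ← setLIntegral_congr Ioo_ae_eq_Ioc, lintegral_const_mul _ (by fun_prop),
      lintegral_Ioo_pow n hv, ← ENNReal.ofReal_mul (by positivity)]
    congr 1
    ring

theorem lintegral_descFactorial_arrivalCount {lam : ℝ} (hlam : 0 < lam) {v : ℝ} (hv : 0 ≤ v)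
    (k : ℕ) :
    ∫⁻ g, ((arrivalCount v g).descFactorial k : ℝ≥0∞) ∂gapLaw lam
      = ENNReal.ofReal ((lam * v) ^ k) := by
  have hA : Measurable (arrivalCount v) := measurable_arrivalCount.comp measurable_prodMk_left
  rw [← lintegral_map (f := fun n : ℕ => (n.descFactorial k : ℝ≥0∞)) (by fun_prop) hA,
    lintegral_countable']
  have h : ∀ n : ℕ, (n.descFactorial k : ℝ≥0∞) * (gapLaw lam).map (arrivalCount v) {n}
      = ENNReal.ofReal (n.descFactorial k * ((lam * v) ^ n / (n.factorial : ℝ)) *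
        Real.exp (-(lam * v))) := by
    intro n
    have h2 := gapLaw_arrivalCount_eq hlam hv n
    rw [Measure.map_apply hA (measurableSet_singleton n),
      show arrivalCount v ⁻¹' {n} = {g | arrivalCount v g = n} from rfl, h2, mul_assoc,
      ENNReal.ofReal_mul (Nat.cast_nonneg _), ENNReal.ofReal_natCast]
  simp_rw [h]
  have hs : HasSum (fun n : ℕ => (n.descFactorial k : ℝ) * ((lam * v) ^ n / (n.factorial : ℝ)))
      ((lam * v) ^ k * Real.exp (lam * v)) := by
    -- The terms with index below `k` vanish; shifting by `k` leaves the exponential series times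
    -- `(lam * v) ^ k`.
    rw [← hasSum_nat_add_iff' k, Finset.sum_eq_zero, sub_zero]
    · rw [Real.exp_eq_exp_ℝ]
      refine ((NormedSpace.expSeries_div_hasSum_exp (lam * v)).mul_left _).congr_fun fun n => ?_
      have h3 := Nat.factorial_mul_descFactorial (Nat.le_add_left k n)
      rw [Nat.add_sub_cancel] at h3
      rw [← h3]
      have h4 : ((n + k).descFactorial k : ℝ) ≠ 0 := by
        rw [Nat.cast_ne_zero]
        intro h0
        rw [h0, mul_zero] at h3
        exact Nat.factorial_ne_zero _ h3.symm
      have h5 : (n.factorial : ℝ) ≠ 0 := by positivity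
      push_cast
      field_simp
      ring
    · intro n hn
      rw [Nat.descFactorial_of_lt (Finset.mem_range.1 hn)]
      simp
  have hs := hs.mul_right (Real.exp (-(lam * v)))
  rw [mul_assoc, ← Real.exp_add, add_neg_cancel, Real.exp_zero, mul_one] at hs
  rw [← ENNReal.ofReal_tsum_of_nonneg (fun n => by positivity) hs.summable, hs.tsum_eq]

/-- Total time spent in the zone, at time `v`, by the trucks that arrived in `[0, v]`. -/
def newAge (v : ℝ) (g : ℕ → ℝ) : ℝ :=
  ∑ j ∈ Finset.range (arrivalCount v g), (v - partialTime j g)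

theorem newAge_nonneg (v : ℝ) (g : ℕ → ℝ) : 0 ≤ newAge v g :=
  Finset.sum_nonneg fun _ hj =>
    sub_nonneg.2 (not_lt.1 fun hc => Nat.notMem_of_lt_sInf (Finset.mem_range.1 hj) hc)

/-- Campbell's formula for the function (v - t)⁺. Since `ENNReal.ofReal` is 0 on negative numbers,
arrivals after `v` drop out and the random finite sum becomes a full series. -/
theorem lintegral_newAge {lam : ℝ} (hlam : 0 < lam) {v : ℝ} (hv : 0 ≤ v) :
    ∫⁻ g, ENNReal.ofReal (newAge v g) ∂gapLaw lam = ENNReal.ofReal (lam * (v ^ 2 / 2)) := by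
  have h : ∀ᵐ g ∂gapLaw lam, ENNReal.ofReal (newAge v g)
      = ∑' n, ENNReal.ofReal (v - partialTime n g) := by
    filter_upwards [ae_exists_lt_partialTime hlam v, ae_gap_pos hlam] with g hg hp
    rw [tsum_eq_sum (s := Finset.range (arrivalCount v g)), newAge, ENNReal.ofReal_sum_of_nonneg]
    · intro j hj
      rw [sub_nonneg, ← lt_arrivalCount_iff hp hg]
      exact Finset.mem_range.1 hj
    · intro j hj
      rw [Finset.mem_range, lt_arrivalCount_iff hp hg] at hj
      exact ENNReal.ofReal_of_nonpos (by linarith)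
  rw [lintegral_congr_ae h, lintegral_tsum_partialTime hlam (f := fun t => ENNReal.ofReal (v - t))
    (by fun_prop), ENNReal.ofReal_mul hlam.le]
  congr 1
  have h2 : ∀ t, ENNReal.ofReal (v - t)
      = (Set.Iic v).indicator (fun t => ENNReal.ofReal (v - t)) t := by
    intro t
    by_cases ht : t ≤ v
    · rw [Set.indicator_of_mem (Set.mem_Iic.2 ht)]
    · rw [Set.indicator_of_notMem (by simpa using ht), ENNReal.ofReal_of_nonpos (by linarith)]
  rw [lintegral_congr h2, lintegral_indicator measurableSet_Iic,
    Measure.restrict_restrict measurableSet_Iic, Set.Iic_inter_Ioi,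
    ← ofReal_integral_eq_lintegral_ofReal, ← intervalIntegral.integral_of_le hv,
    intervalIntegral.integral_comp_sub_left (fun t => t), integral_id]
  · congr 1
    ring
  · exact (by fun_prop : Continuous fun t : ℝ => v - t).integrableOn_Ioc
  · refine (ae_restrict_iff' measurableSet_Ioc).2 (ae_of_all _ fun x hx => ?_)
    exact sub_nonneg.2 hx.2

theorem integrable_and_integral_of_lintegral {α : Type*} [MeasurableSpace α] {μ : Measure α}
    {f : α → ℝ} (hf : AEStronglyMeasurable f μ) (h0 : 0 ≤ᵐ[μ] f) {c : ℝ} (hc : 0 ≤ c)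
    (h : ∫⁻ x, ENNReal.ofReal (f x) ∂μ = ENNReal.ofReal c) :
    Integrable f μ ∧ ∫ x, f x ∂μ = c := by
  have hi : Integrable f μ :=
    (lintegral_ofReal_ne_top_iff_integrable hf h0).1 (h ▸ ENNReal.ofReal_ne_top)
  refine ⟨hi, ?_⟩
  rw [integral_eq_lintegral_of_nonneg_ae h0 hf, h, ENNReal.toReal_ofReal hc]

/-! ### The idle period -/

/-- Probability that the next truck served is a waiting one, given that `k` trucks wait. -/
def retryProb (lam θ : ℝ) (k : ℕ) : ℝ := k * θ / (lam + k * θ)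

section Clocks

variable {lam θ : ℝ} (hlam : 0 < lam) (hθ : 0 < θ)

include hlam hθ

theorem rate_pos (k : ℕ) : 0 < lam + k * θ := by positivity

theorem retryProb_nonneg (k : ℕ) : 0 ≤ retryProb lam θ k := by unfold retryProb; positivity

theorem one_sub_retryProb (k : ℕ) : 1 - retryProb lam θ k = lam / (lam + k * θ) := by
  have := rate_pos hlam hθ k
  unfold retryProb
  field_simp
  ring

theorem retryProb_le_one (k : ℕ) : retryProb lam θ k ≤ 1 := by
  have := rate_pos hlam hθ k
  rw [← sub_nonneg, one_sub_retryProb hlam hθ]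
  positivity

/-- Given the next arrival at `x`, no retrial precedes it with probability exp(-kθx); integrate over
`x`. -/
theorem prod_expMeasure_no_retry (k : ℕ) :
    (expMeasure lam).prod (expMeasure θ) {c | ¬ (0 < k ∧ c.2 / k < c.1)}
      = ENNReal.ofReal (lam / (lam + k * θ)) := by
  have := isProbabilityMeasure_expMeasure hlam
  have := isProbabilityMeasure_expMeasure hθ
  rcases Nat.eq_zero_or_pos k with rfl | hk
  · simp [div_self hlam.ne']
  · have hk' : (0 : ℝ) < k := Nat.cast_pos.2 hk
    have hS : MeasurableSet {c : ℝ × ℝ | ¬ (0 < k ∧ c.2 / k < c.1)} := by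
      simp only [hk, true_and, not_lt]
      exact measurableSet_le measurable_fst (measurable_snd.div_const _)
    rw [Measure.prod_apply hS, lintegral_expMeasure (measurable_measure_prodMk_left hS)]
    have h : ∀ x ∈ Set.Ioi (0 : ℝ), ENNReal.ofReal (lam * Real.exp (-(lam * x))) *
        expMeasure θ (Prod.mk x ⁻¹' {c : ℝ × ℝ | ¬ (0 < k ∧ c.2 / k < c.1)})
        = ENNReal.ofReal lam * ENNReal.ofReal (Real.exp (-((lam + k * θ) * x))) := by
      intro x hx
      have hx : 0 < x := hx
      have h2 : Prod.mk x ⁻¹' {c : ℝ × ℝ | ¬ (0 < k ∧ c.2 / k < c.1)} = Set.Ici (x * k) := by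
        ext y
        simp [hk, le_div_iff₀ hk']
      rw [h2, expMeasure_Ici hθ (by positivity), ← ENNReal.ofReal_mul (by positivity),
        ← ENNReal.ofReal_mul hlam.le, mul_assoc, ← Real.exp_add]
      congr 3
      ring
    rw [setLIntegral_congr_fun measurableSet_Ioi h, lintegral_const_mul _ (by fun_prop),
      lintegral_Ioi_exp_neg (rate_pos hlam hθ k), ← ENNReal.ofReal_mul hlam.le]
    congr 1
    simp [div_eq_mul_inv]

open Classical in
-- The idle period is the minimum of independent exponentials of rates λ and kθ, so its tail is
-- exponential of rate λ + kθ, and the mean is the integral of the tail. For `k = 0` the guard `0 <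
-- k` discards the meaningless quotient by zero.
theorem lintegral_idle (k : ℕ) :
    ∫⁻ c : ℝ × ℝ, ENNReal.ofReal (if 0 < k ∧ c.2 / k < c.1 then c.2 / k else c.1)
      ∂(expMeasure lam).prod (expMeasure θ) = ENNReal.ofReal (1 / (lam + k * θ)) := by
  have := isProbabilityMeasure_expMeasure hlam
  have := isProbabilityMeasure_expMeasure hθ
  have key : ∀ t : ℝ, 0 < t → (expMeasure lam).prod (expMeasure θ)
      {c | t < if 0 < k ∧ c.2 / k < c.1 then c.2 / k else c.1}
      = ENNReal.ofReal (Real.exp (-((lam + k * θ) * t))) := by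
    intro t ht
    rcases Nat.eq_zero_or_pos k with rfl | hk
    · have h2 : {c : ℝ × ℝ | t < if 0 < 0 ∧ c.2 / (0 : ℕ) < c.1 then c.2 / (0 : ℕ) else c.1}
          = Set.Ioi t ×ˢ Set.univ := by
        ext c; simp
      rw [h2, Measure.prod_prod, expMeasure_Ioi hlam ht.le]
      simp
    · have hk' : (0 : ℝ) < k := Nat.cast_pos.2 hk
      have h2 : {c : ℝ × ℝ | t < if 0 < k ∧ c.2 / k < c.1 then c.2 / k else c.1}
          = Set.Ioi t ×ˢ Set.Ioi (t * k) := by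
        ext c
        simp only [hk, true_and, Set.mem_ofPred_eq, Set.mem_prod, Set.mem_Ioi,
          ← lt_div_iff₀ hk']
        split_ifs with h
        · exact ⟨fun h1 => ⟨h1.trans h, h1⟩, fun h1 => h1.2⟩
        · exact ⟨fun h1 => ⟨h1, h1.trans_le (not_lt.1 h)⟩, fun h1 => h1.1⟩
      rw [h2, Measure.prod_prod, expMeasure_Ioi hlam ht.le, expMeasure_Ioi hθ (by positivity),
        ← ENNReal.ofReal_mul (Real.exp_pos _).le, ← Real.exp_add]
      congr 2
      ring
  have hm : Measurable fun c : ℝ × ℝ => if 0 < k ∧ c.2 / k < c.1 then c.2 / (k : ℝ) else c.1 := by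
    refine Measurable.ite ?_ (by fun_prop) (by fun_prop)
    exact (MeasurableSet.const _).inter (measurableSet_lt (measurable_snd.div_const _) measurable_fst)
  have h0 : 0 ≤ᵐ[(expMeasure lam).prod (expMeasure θ)]
      fun c : ℝ × ℝ => if 0 < k ∧ c.2 / k < c.1 then c.2 / (k : ℝ) else c.1 := by
    have h1 := Measure.quasiMeasurePreserving_fst (μ := expMeasure lam) (ν := expMeasure θ)
      |>.ae (ae_pos_expMeasure lam)
    have h2 := Measure.quasiMeasurePreserving_snd (μ := expMeasure lam) (ν := expMeasure θ)
      |>.ae (ae_pos_expMeasure θ)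
    filter_upwards [h1, h2] with c hc1 hc2
    dsimp only [Pi.zero_apply]
    split_ifs
    · positivity
    · exact hc1.le
  rw [lintegral_eq_lintegral_meas_lt _ h0 hm.aemeasurable,
    setLIntegral_congr_fun measurableSet_Ioi key, lintegral_Ioi_exp_neg (rate_pos hlam hθ k)]
  simp

end Clocks

/-! ### The variables of one cycle -/

/-- The selector is projected away: the balances that give the means do not depend on which waiting
truck is chosen. The clocks and the service with its arrivals remain as two independent blocks. -/
theorem measurePreserving_cycleLaw {lam θ : ℝ} (hlam : 0 < lam) (hθ : 0 < θ)
    (B : Measure ℝ) [IsProbabilityMeasure B] :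
    MeasurePreserving (fun ω : Cycle => ((ω.1, ω.2.1), ω.2.2.2)) (cycleLaw lam θ B)
      (((expMeasure lam).prod (expMeasure θ)).prod (B.prod (gapLaw lam))) := by
  have := isProbabilityMeasure_expMeasure hlam
  have := isProbabilityMeasure_expMeasure hθ
  have : IsProbabilityMeasure (volume.restrict (Set.Ico (0 : ℝ) 1)) := ⟨by simp⟩
  have h1 : MeasurePreserving (fun ω : Cycle => (ω.1, ω.2.1, ω.2.2.2)) (cycleLaw lam θ B)
      ((expMeasure lam).prod ((expMeasure θ).prod (B.prod (gapLaw lam)))) :=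
    (MeasurePreserving.id _).prod ((MeasurePreserving.id _).prod measurePreserving_snd)
  have h2 : MeasurePreserving (MeasurableEquiv.prodAssoc (α := ℝ) (β := ℝ) (γ := ℝ × (ℕ → ℝ)))
      (((expMeasure lam).prod (expMeasure θ)).prod (B.prod (gapLaw lam)))
      ((expMeasure lam).prod ((expMeasure θ).prod (B.prod (gapLaw lam)))) :=
    ⟨MeasurableEquiv.measurable _, Measure.prodAssoc_prod⟩
  exact (h2.symm).comp h1

theorem isProbabilityMeasure_cycleLaw {lam θ : ℝ} (hlam : 0 < lam) (hθ : 0 < θ)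
    (B : Measure ℝ) [IsProbabilityMeasure B] : IsProbabilityMeasure (cycleLaw lam θ B) := by
  have := isProbabilityMeasure_expMeasure hlam
  have := isProbabilityMeasure_expMeasure hθ
  have : IsProbabilityMeasure (volume.restrict (Set.Ico (0 : ℝ) 1)) := ⟨by simp⟩
  unfold cycleLaw
  infer_instance

theorem measurableSet_retries : MeasurableSet {x : ZoneState × Cycle | Retries x.1 x.2} := by
  have hc : Measurable fun x : ZoneState × Cycle => (x.1.1 : ℝ) := by fun_prop
  have h1 : MeasurableSet {x : ZoneState × Cycle | 0 < x.1.1} :=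
    measurable_fst.comp measurable_fst (measurableSet_Ioi (a := 0))
  have h2 : MeasurableSet {x : ZoneState × Cycle | x.2.2.1 / x.1.1 < x.2.1} :=
    measurableSet_lt (Measurable.div (by fun_prop) hc) (by fun_prop)
  exact h1.inter h2

theorem measurableSet_retries_right (s : ZoneState) : MeasurableSet {ω | Retries s ω} :=
  measurable_prodMk_left measurableSet_retries

@[fun_prop]
theorem measurable_idleTime : Measurable fun x : ZoneState × Cycle => idleTime x.1 x.2 := by
  unfold idleTime
  refine Measurable.ite measurableSet_retries ?_ ?_
  · have hc : Measurable fun x : ZoneState × Cycle => (x.1.1 : ℝ) := by fun_prop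
    exact Measurable.div (by unfold Cycle.retrialClock; fun_prop) hc
  · unfold Cycle.nextArrival; fun_prop

open Classical in
/-- Indicator of a retrial. -/
def retryInd (s : ZoneState) (ω : Cycle) : ℝ := if Retries s ω then 1 else 0

@[fun_prop]
theorem measurable_retryInd : Measurable fun x : ZoneState × Cycle => retryInd x.1 x.2 :=
  Measurable.ite measurableSet_retries measurable_const measurable_const

theorem retryInd_nonneg (s : ZoneState) (ω : Cycle) : 0 ≤ retryInd s ω := by
  unfold retryInd; split_ifs <;> simp

theorem retryInd_le_one (s : ZoneState) (ω : Cycle) : retryInd s ω ≤ 1 := by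
  unfold retryInd; split_ifs <;> simp

theorem retryInd_mul_self (s : ZoneState) (ω : Cycle) :
    retryInd s ω * retryInd s ω = retryInd s ω := by
  unfold retryInd; split_ifs <;> simp

theorem Cycle.arrivals_eq (ω : Cycle) : ω.arrivals = arrivalCount ω.2.2.2.1 ω.2.2.2.2 := rfl

@[fun_prop]
theorem measurable_arrivals : Measurable Cycle.arrivals :=
  measurable_arrivalCount.comp (f := fun ω : Cycle => ω.2.2.2) (by fun_prop)

@[fun_prop]
theorem measurable_service : Measurable Cycle.service := by unfold Cycle.service; fun_prop

section CycleLaw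

variable {lam θ : ℝ} (hlam : 0 < lam) (hθ : 0 < θ) (B : Measure ℝ) [IsProbabilityMeasure B]

include hlam hθ

theorem measurePreserving_clocks :
    MeasurePreserving (fun ω : Cycle => (ω.1, ω.2.1)) (cycleLaw lam θ B)
      ((expMeasure lam).prod (expMeasure θ)) := by
  have := isProbabilityMeasure_expMeasure hlam
  exact measurePreserving_fst.comp (measurePreserving_cycleLaw hlam hθ B)

theorem measurePreserving_service_gaps :
    MeasurePreserving (fun ω : Cycle => ω.2.2.2) (cycleLaw lam θ B) (B.prod (gapLaw lam)) := by
  have := isProbabilityMeasure_expMeasure hlam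
  have := isProbabilityMeasure_expMeasure hθ
  exact (measurePreserving_snd (μ := (expMeasure lam).prod (expMeasure θ))).comp
    (measurePreserving_cycleLaw hlam hθ B)

theorem indepFun_clocks_service_gaps :
    IndepFun (fun ω : Cycle => (ω.1, ω.2.1)) (fun ω : Cycle => ω.2.2.2) (cycleLaw lam θ B) := by
  have := isProbabilityMeasure_cycleLaw hlam hθ B
  rw [indepFun_iff_map_prod_eq_prod_map_map (by fun_prop) (by fun_prop),
    (measurePreserving_clocks hlam hθ B).map_eq, (measurePreserving_service_gaps hlam hθ B).map_eq]
  exact (measurePreserving_cycleLaw hlam hθ B).map_eq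

theorem indepFun_retryInd_service_gaps (s : ZoneState) :
    IndepFun (retryInd s) (fun ω : Cycle => ω.2.2.2) (cycleLaw lam θ B) := by
  have h : Measurable ({c : ℝ × ℝ | 0 < s.1 ∧ c.2 / s.1 < c.1}.indicator (1 : ℝ × ℝ → ℝ)) :=
    measurable_one.indicator ((MeasurableSet.const _).inter
      (measurableSet_lt (measurable_snd.div_const _) measurable_fst))
  exact (indepFun_clocks_service_gaps hlam hθ B).comp h measurable_id

theorem cycleLaw_real_not_retries (s : ZoneState) :
    (cycleLaw lam θ B).real {ω | ¬ Retries s ω} = lam / (lam + s.1 * θ) := by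
  have := rate_pos hlam hθ s.1
  have h := prod_expMeasure_no_retry hlam hθ s.1
  rw [← (measurePreserving_clocks hlam hθ B).measure_preimage] at h
  · rw [measureReal_def, show {ω : Cycle | ¬ Retries s ω} = (fun ω : Cycle => (ω.1, ω.2.1)) ⁻¹'
      {c | ¬ (0 < s.1 ∧ c.2 / s.1 < c.1)} from rfl, h, ENNReal.toReal_ofReal (by positivity)]
  · exact ((MeasurableSet.const _).inter
      (measurableSet_lt (measurable_snd.div_const _) measurable_fst)).compl.nullMeasurableSet

theorem cycleLaw_real_retries (s : ZoneState) :
    (cycleLaw lam θ B).real {ω | Retries s ω} = retryProb lam θ s.1 := by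
  have := isProbabilityMeasure_cycleLaw hlam hθ B
  have h := cycleLaw_real_not_retries hlam hθ B s
  rw [← one_sub_retryProb hlam hθ, ← Set.compl_ofPred,
    probReal_compl_eq_one_sub (measurableSet_retries_right s)] at h
  linarith

theorem integrable_retryInd (s : ZoneState) : Integrable (retryInd s) (cycleLaw lam θ B) := by
  have := isProbabilityMeasure_cycleLaw hlam hθ B
  refine Integrable.of_bound (C := 1)
    (measurable_retryInd.comp measurable_prodMk_left).aestronglyMeasurable (ae_of_all _ fun ω => ?_)
  rw [Real.norm_of_nonneg (retryInd_nonneg s ω)]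
  exact retryInd_le_one s ω

theorem integral_retryInd (s : ZoneState) :
    ∫ ω, retryInd s ω ∂cycleLaw lam θ B = retryProb lam θ s.1 := by
  rw [← cycleLaw_real_retries hlam hθ B s, ← integral_indicator_one (measurableSet_retries_right s)]
  rfl

theorem integral_retryInd_mul (s : ZoneState) {h : ℝ × (ℕ → ℝ) → ℝ} (hh : Measurable h) :
    ∫ ω : Cycle, retryInd s ω * h ω.2.2.2 ∂cycleLaw lam θ B
      = retryProb lam θ s.1 * ∫ ω : Cycle, h ω.2.2.2 ∂cycleLaw lam θ B := by
  rw [← integral_retryInd hlam hθ B s]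
  have h1 : Measurable (retryInd s) := measurable_retryInd.comp measurable_prodMk_left
  exact ((indepFun_retryInd_service_gaps hlam hθ B s).comp measurable_id
    hh).integral_fun_mul_eq_mul_integral h1.aestronglyMeasurable
      (hh.comp (by fun_prop : Measurable fun ω : Cycle => ω.2.2.2)).aestronglyMeasurable

theorem ae_cycle (hB : ∀ᵐ t ∂B, 0 ≤ t) : ∀ᵐ ω ∂cycleLaw lam θ B,
    0 < ω.nextArrival ∧ 0 < ω.retrialClock ∧ (0 ≤ ω.selector ∧ ω.selector < 1) ∧
      0 ≤ ω.service ∧ (∀ n, 0 < ω.gap n) ∧ ∃ n, ω.service < ω.arrivalTime n := by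
  have := isProbabilityMeasure_expMeasure hlam
  have := isProbabilityMeasure_expMeasure hθ
  have : IsProbabilityMeasure (volume.restrict (Set.Ico (0 : ℝ) 1)) := ⟨by simp⟩
  have hc := measurePreserving_clocks hlam hθ B
  have hg := measurePreserving_service_gaps hlam hθ B
  have hS : MeasurePreserving (fun ω : Cycle => ω.2.2.1) (cycleLaw lam θ B)
      (volume.restrict (Set.Ico (0 : ℝ) 1)) :=
    measurePreserving_fst.comp (measurePreserving_snd.comp measurePreserving_snd)
  have h3 : ∀ᵐ x ∂B.prod (gapLaw lam), ∃ n, x.1 < partialTime n x.2 := by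
    refine (Measure.ae_prod_iff_ae_ae ?_).2 (ae_of_all _ fun v => ae_exists_lt_partialTime hlam v)
    simp only [Set.ofPred_exists]
    exact MeasurableSet.iUnion fun n => measurableSet_lt measurable_fst (by fun_prop)
  filter_upwards [hc.quasiMeasurePreserving.ae
      (Measure.quasiMeasurePreserving_fst.ae (ae_pos_expMeasure lam)),
    hc.quasiMeasurePreserving.ae (Measure.quasiMeasurePreserving_snd.ae (ae_pos_expMeasure θ)),
    hS.quasiMeasurePreserving.ae (ae_restrict_mem measurableSet_Ico),
    hg.quasiMeasurePreserving.ae (Measure.quasiMeasurePreserving_fst.ae hB),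
    hg.quasiMeasurePreserving.ae (Measure.quasiMeasurePreserving_snd.ae (ae_gap_pos hlam)),
    hg.quasiMeasurePreserving.ae h3] with ω h1 h2 h3 h4 h5 h6
  exact ⟨h1, h2, h3, h4, h5, h6⟩

theorem integrable_idleTime_and_integral (s : ZoneState) :
    Integrable (idleTime s) (cycleLaw lam θ B) ∧
      ∫ ω, idleTime s ω ∂cycleLaw lam θ B = 1 / (lam + s.1 * θ) := by
  classical
  have h0 := rate_pos hlam hθ s.1
  have hm : Measurable (idleTime s) := measurable_idleTime.comp measurable_prodMk_left
  refine integrable_and_integral_of_lintegral hm.aestronglyMeasurable ?_ (by positivity) ?_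
  · have hc := measurePreserving_clocks hlam hθ B
    have := isProbabilityMeasure_expMeasure hlam
    have := isProbabilityMeasure_expMeasure hθ
    filter_upwards [hc.quasiMeasurePreserving.ae
      (Measure.quasiMeasurePreserving_fst.ae (ae_pos_expMeasure lam)),
      hc.quasiMeasurePreserving.ae (Measure.quasiMeasurePreserving_snd.ae (ae_pos_expMeasure θ))]
      with ω h1 h2
    simp only [idleTime, retrialTime, Pi.zero_apply, Cycle.retrialClock, Cycle.nextArrival]
    split_ifs
    · positivity
    · exact h1.le
  · rw [← lintegral_idle hlam hθ s.1, ← (measurePreserving_clocks hlam hθ B).lintegral_comp]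
    · refine lintegral_congr fun ω => congrArg _ ?_
      by_cases h : Retries s ω
      · rw [idleTime, if_pos h, if_pos (show 0 < s.1 ∧ ω.2.1 / s.1 < ω.1 from h)]
        rfl
      · rw [idleTime, if_neg h, if_neg (show ¬ (0 < s.1 ∧ ω.2.1 / s.1 < ω.1) from h)]
        rfl
    · refine Measurable.ennreal_ofReal (Measurable.ite ?_ (by fun_prop) (by fun_prop))
      exact (MeasurableSet.const _).inter
        (measurableSet_lt (measurable_snd.div_const _) measurable_fst)

theorem lintegral_service_gaps {h : ℝ × (ℕ → ℝ) → ℝ≥0∞} (hh : Measurable h) :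
    ∫⁻ ω : Cycle, h ω.2.2.2 ∂cycleLaw lam θ B = ∫⁻ v, ∫⁻ g, h (v, g) ∂gapLaw lam ∂B := by
  have := isProbabilityMeasure_expMeasure hlam
  rw [(measurePreserving_service_gaps hlam hθ B).lintegral_comp hh, lintegral_prod _ hh.aemeasurable]

theorem cycleLaw_real_arrivals_eq (hB : ∀ᵐ t ∂B, 0 ≤ t) (n : ℕ) :
    (cycleLaw lam θ B).real {ω | ω.arrivals = n} = arrivalProb lam B n := by
  have := isProbabilityMeasure_expMeasure hlam
  have hS : MeasurableSet {x : ℝ × (ℕ → ℝ) | arrivalCount x.1 x.2 = n} :=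
    measurable_arrivalCount (measurableSet_singleton n)
  rw [measureReal_def, show {ω : Cycle | ω.arrivals = n} = (fun ω : Cycle => ω.2.2.2) ⁻¹'
      {x : ℝ × (ℕ → ℝ) | arrivalCount x.1 x.2 = n} from rfl,
    (measurePreserving_service_gaps hlam hθ B).measure_preimage hS.nullMeasurableSet,
    Measure.prod_apply hS, arrivalProb, integral_eq_lintegral_of_nonneg_ae]
  · congr 1
    refine lintegral_congr_ae ?_
    filter_upwards [hB] with v hv
    exact gapLaw_arrivalCount_eq hlam hv n
  · filter_upwards [hB] with v hv
    dsimp only [Pi.zero_apply]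
    positivity
  · exact (by fun_prop : Measurable fun t =>
      (lam * t) ^ n / (n.factorial : ℝ) * Real.exp (-(lam * t))).aestronglyMeasurable

theorem integrable_descFactorial_arrivals_and_integral (hB : ∀ᵐ t ∂B, 0 ≤ t) (k : ℕ)
    (hk : Integrable (fun t => t ^ k) B) :
    Integrable (fun ω => (ω.arrivals.descFactorial k : ℝ)) (cycleLaw lam θ B) ∧
      ∫ ω, (ω.arrivals.descFactorial k : ℝ) ∂cycleLaw lam θ B = lam ^ k * ∫ t, t ^ k ∂B := by
  have hd : Measurable fun n : ℕ => (n.descFactorial k : ℝ) := by fun_prop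
  have hd' : Measurable fun n : ℕ => (n.descFactorial k : ℝ≥0∞) := by fun_prop
  have h0 : 0 ≤ᵐ[B] fun t => t ^ k := by
    filter_upwards [hB] with t ht
    exact pow_nonneg ht k
  refine integrable_and_integral_of_lintegral (hd.comp measurable_arrivals).aestronglyMeasurable
    (ae_of_all _ fun ω => Nat.cast_nonneg _)
    (mul_nonneg (by positivity) (integral_nonneg_of_ae h0)) ?_
  simp only [Function.comp_def, ENNReal.ofReal_natCast, Cycle.arrivals_eq]
  rw [lintegral_service_gaps hlam hθ B (h := fun x => ((arrivalCount x.1 x.2).descFactorial k : ℝ≥0∞))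
    (hd'.comp measurable_arrivalCount), ← integral_const_mul,
    ofReal_integral_eq_lintegral_ofReal (hk.const_mul _)]
  · refine lintegral_congr_ae ?_
    filter_upwards [hB] with v hv
    rw [lintegral_descFactorial_arrivalCount hlam hv, mul_pow]
  · filter_upwards [h0] with t ht
    exact mul_nonneg (by positivity) ht

theorem integrable_newAge_and_integral (hB : ∀ᵐ t ∂B, 0 ≤ t)
    (hB₂ : Integrable (fun t => t ^ 2) B) :
    Integrable (fun ω : Cycle => newAge ω.2.2.2.1 ω.2.2.2.2) (cycleLaw lam θ B) ∧
      ∫ ω : Cycle, newAge ω.2.2.2.1 ω.2.2.2.2 ∂cycleLaw lam θ B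
        = lam * (∫ t, t ^ 2 ∂B) / 2 := by
  have hm : Measurable fun x : ℝ × (ℕ → ℝ) => newAge x.1 x.2 := by
    have h := measurable_from_prod_countable_right (f := fun y : ℕ × (ℝ × (ℕ → ℝ)) =>
      ∑ j ∈ Finset.range y.1, (y.2.1 - partialTime j y.2.2)) fun n =>
        Finset.measurable_fun_sum (Finset.range n) fun j _ => measurable_fst.sub
          ((measurable_partialTime j).comp measurable_snd)
    exact h.comp (measurable_arrivalCount.prodMk measurable_id)
  refine integrable_and_integral_of_lintegral
    (hm.comp (by fun_prop : Measurable fun ω : Cycle => ω.2.2.2)).aestronglyMeasurable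
    (ae_of_all _ fun ω => newAge_nonneg _ _)
    (div_nonneg (mul_nonneg hlam.le (integral_nonneg fun t => by positivity)) zero_le_two) ?_
  simp only [Function.comp_def]
  rw [lintegral_service_gaps hlam hθ B (h := fun x => ENNReal.ofReal (newAge x.1 x.2))
    hm.ennreal_ofReal, mul_div_assoc, ← integral_div, ← integral_const_mul,
    ofReal_integral_eq_lintegral_ofReal ((hB₂.div_const _).const_mul _)
      (ae_of_all _ fun t => by dsimp only [Pi.zero_apply]; positivity)]
  refine lintegral_congr_ae ?_
  filter_upwards [hB] with v hv
  exact lintegral_newAge hlam hv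

theorem measurePreserving_service : MeasurePreserving Cycle.service (cycleLaw lam θ B) B := by
  have := isProbabilityMeasure_expMeasure hlam
  exact measurePreserving_fst.comp (measurePreserving_service_gaps hlam hθ B)

end CycleLaw

/-! ### Measurability of the dynamics -/

/-- For evaluations at a random index: measurability may be checked on each of the countably many
values of the index. -/
theorem measurable_eval_nat {α β : Type*} [MeasurableSpace α] [MeasurableSpace β]
    {f : ℕ → β → ℝ} (hf : ∀ n, Measurable (f n)) {n : α → ℕ} (hn : Measurable n) {g : α → β}
    (hg : Measurable g) : Measurable fun a => f (n a) (g a) :=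
  (measurable_from_prod_countable_right (f := fun y : ℕ × β => f y.1 y.2) hf).comp (hn.prodMk hg)

theorem measurable_selected : Measurable fun x : ZoneState × Cycle => selected x.1 x.2 := by
  have hc : Measurable fun x : ZoneState × Cycle => (x.1.1 : ℝ) := by fun_prop
  exact Measurable.nat_floor (Measurable.mul (by unfold Cycle.selector; fun_prop) hc)

theorem measurable_remaining : Measurable fun x : ZoneState × Cycle => remaining x.1 x.2 :=
  Measurable.ite measurableSet_retries (by fun_prop) (by fun_prop)

theorem measurable_oldIndex (i : ℕ) :
    Measurable fun x : ZoneState × Cycle => oldIndex x.1 x.2 i :=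
  Measurable.ite (measurableSet_retries.inter (measurable_selected (measurableSet_Iic (a := i))))
    measurable_const measurable_const

theorem measurable_arrivalTime (n : ℕ) : Measurable fun ω : Cycle => ω.arrivalTime n :=
  (measurable_partialTime n).comp (by fun_prop : Measurable fun ω : Cycle => ω.2.2.2.2)

theorem measurable_nextState : Measurable fun x : ZoneState × Cycle => nextState x.1 x.2 := by
  have hr := measurable_remaining
  have ha : Measurable fun x : ZoneState × Cycle => x.2.arrivals := by fun_prop
  refine (hr.add ha).prodMk (measurable_pi_lambda _ fun i => ?_)
  refine Measurable.ite (measurableSet_lt measurable_const hr) ?_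
    (Measurable.ite (measurableSet_lt measurable_const (hr.add ha)) ?_ measurable_const)
  · exact ((measurable_eval_nat (f := fun n (g : ℕ → ℝ) => g n) (fun n => measurable_pi_apply n)
      (measurable_oldIndex i) (by fun_prop : Measurable fun x : ZoneState × Cycle => x.1.2)).add
        measurable_idleTime).add (by fun_prop)
  · exact Measurable.sub (by fun_prop)
      (measurable_eval_nat (f := fun n (ω : Cycle) => ω.arrivalTime n) measurable_arrivalTime
        (measurable_const.sub hr) measurable_snd)

/-! ### Evolution of the number of waiting trucks and of their ages -/

theorem nextState_fst (s : ZoneState) (ω : Cycle) :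
    (nextState s ω).1 = remaining s ω + ω.arrivals := rfl

theorem nextState_fst_cast (s : ZoneState) (ω : Cycle) :
    ((nextState s ω).1 : ℝ) = s.1 - retryInd s ω + ω.arrivals := by
  rw [nextState_fst, remaining, retryInd]
  split_ifs with h
  · push_cast [Nat.cast_sub (show 1 ≤ s.1 from h.1)]
    rfl
  · simp

/-- The reindexing enumerates all indices below `m + 1` except `j`: this is the removal of the
selected truck. -/
theorem sum_range_skip (f : ℕ → ℝ) {j m : ℕ} (hj : j ≤ m) :
    ∑ i ∈ Finset.range m, f (if j ≤ i then i + 1 else i) + f j = ∑ i ∈ Finset.range (m + 1), f i := by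
  induction m with
  | zero => simp [Nat.le_zero.1 hj]
  | succ m ih =>
    rcases hj.lt_or_eq with h | rfl
    · rw [Finset.sum_range_succ, Finset.sum_range_succ _ (m + 1), ← ih (Nat.lt_succ_iff.1 h),
        if_pos (Nat.lt_succ_iff.1 h)]
      ring
    · rw [Finset.sum_range_succ _ (m + 1)]
      congr 1
      refine Finset.sum_congr rfl fun i hi => ?_
      rw [if_neg (not_le.2 (Finset.mem_range.1 hi))]

/-- Total age of the waiting trucks. -/
def totalAge (s : ZoneState) : ℝ := ∑ i ∈ Finset.range s.1, s.2 i

theorem measurable_totalAge : Measurable totalAge :=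
  measurable_eval_nat (f := fun n (g : ℕ → ℝ) => ∑ i ∈ Finset.range n, g i)
    (fun n => by fun_prop) measurable_fst measurable_snd

theorem selected_lt {s : ZoneState} {ω : Cycle} (hs : 0 < s.1) (hω : 0 ≤ ω.selector)
    (hω' : ω.selector < 1) : selected s ω < s.1 := by
  have : (0 : ℝ) < s.1 := Nat.cast_pos.2 hs
  rw [selected, Nat.floor_lt (by positivity)]
  nlinarith

/-- Conservation of age along each cycle. Every truck waiting at the start, including a selected one
whose final age is its sojourn time, ages by the idle time plus the service. Newcomers left waiting
contribute `newAge`, and without a retrial the departing truck has spent only its own service. -/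
theorem totalAge_nextState (s : ZoneState) {ω : Cycle} (hω : 0 ≤ ω.selector)
    (hω' : ω.selector < 1) :
    totalAge (nextState s ω) + sojournTime s ω
      = totalAge s + s.1 * (idleTime s ω + ω.service) + newAge ω.2.2.2.1 ω.2.2.2.2
        + (1 - retryInd s ω) * ω.service := by
  have h1 : totalAge (nextState s ω) = ∑ i ∈ Finset.range (remaining s ω), s.2 (oldIndex s ω i)
      + remaining s ω * (idleTime s ω + ω.service) + newAge ω.2.2.2.1 ω.2.2.2.2 := by
    rw [totalAge, nextState_fst, Finset.sum_range_add]
    congr 1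
    · have h2 : ∀ i ∈ Finset.range (remaining s ω), (nextState s ω).2 i
          = s.2 (oldIndex s ω i) + idleTime s ω + ω.service := fun i hi =>
        if_pos (Finset.mem_range.1 hi)
      rw [Finset.sum_congr rfl h2]
      simp only [add_assoc, Finset.sum_add_distrib, Finset.sum_const, Finset.card_range,
        nsmul_eq_mul, mul_add]
    · refine Finset.sum_congr rfl fun i hi => ?_
      have hi : i < ω.arrivals := Finset.mem_range.1 hi
      simp only [nextState]
      rw [if_neg (by omega), if_pos (Nat.add_lt_add_left hi _), Nat.add_sub_cancel_left]
      rfl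
  rw [h1]
  by_cases h : Retries s ω
  · obtain ⟨m, hm⟩ := Nat.exists_eq_add_one_of_ne_zero h.1.ne'
    have h2 := sum_range_skip s.2 (Nat.lt_succ_iff.1 (hm ▸ selected_lt h.1 hω hω'))
    have h3 : remaining s ω = m := by simp [remaining, h, hm]
    rw [h3, totalAge, hm, ← h2]
    simp only [sojournTime, oldIndex, h, retryInd, if_true, true_and]
    push_cast
    ring
  · simp only [remaining, sojournTime, oldIndex, h, retryInd, if_false, false_and, totalAge]
    ring

/-! ### Expected increments in a stationary regime -/

/-- Truncating both variables at `n` gives differences of mean zero that remain below `|Z|`. Fatou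
for `|Z|` minus these differences makes the increment integrable; it then dominates the truncated
differences, and the zero means pass to the limit. Integrability of `X` itself is never required. -/
theorem integrable_sub_of_map_eq {Ω : Type*} [MeasurableSpace Ω] {P : Measure Ω} [IsFiniteMeasure P]
    {X X' Z : Ω → ℝ} (hX : Measurable X) (hX' : Measurable X') (h0 : 0 ≤ᵐ[P] X) (h0' : 0 ≤ᵐ[P] X')
    (hmap : P.map X' = P.map X) (hZ : Integrable Z P) (hle : ∀ᵐ ω ∂P, X' ω - X ω ≤ Z ω) :
    Integrable (fun ω => X' ω - X ω) P ∧ ∫ ω, (X' ω - X ω) ∂P = 0 := by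
  let D : ℕ → Ω → ℝ := fun n ω => min (X' ω) n - min (X ω) n
  have hDm : ∀ n, Measurable (D n) := fun n => by fun_prop
  have hmin : ∀ (Y : Ω → ℝ), Measurable Y → 0 ≤ᵐ[P] Y → ∀ n : ℕ,
      Integrable (fun ω => min (Y ω) (n : ℝ)) P := by
    intro Y hY hY0 n
    refine Integrable.of_bound (C := n) (by fun_prop) ?_
    filter_upwards [hY0] with ω hω
    rw [Real.norm_of_nonneg (le_min hω n.cast_nonneg)]
    exact min_le_right _ _
  have hDi : ∀ n, Integrable (D n) P := fun n => (hmin X' hX' h0' n).sub (hmin X hX h0 n)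
  have hD0 : ∀ n, ∫ ω, D n ω ∂P = 0 := by
    intro n
    have hm : ∀ (Y : Ω → ℝ), Measurable Y → ∫ ω, min (Y ω) (n : ℝ) ∂P
        = ∫ x, min x (n : ℝ) ∂P.map Y := fun Y hY =>
      (integral_map hY.aemeasurable (by fun_prop : Measurable fun x : ℝ =>
        min x (n : ℝ)).aestronglyMeasurable).symm
    rw [integral_sub (hmin X' hX' h0' n) (hmin X hX h0 n), hm X' hX', hm X hX, hmap, sub_self]
  have hlim : ∀ ω, Filter.Tendsto (fun n => D n ω) Filter.atTop (nhds (X' ω - X ω)) := by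
    intro ω
    refine tendsto_const_nhds.congr' ?_
    filter_upwards [Filter.eventually_ge_atTop (max ⌈X' ω⌉₊ ⌈X ω⌉₊)] with n hn
    rw [max_le_iff, Nat.ceil_le, Nat.ceil_le] at hn
    simp only [D, min_eq_left hn.1, min_eq_left hn.2]
  have hDle : ∀ᵐ ω ∂P, ∀ n, D n ω ≤ |Z ω| := by
    filter_upwards [hle] with ω hω n
    have := le_abs_self (Z ω)
    have := abs_nonneg (Z ω)
    simp only [D]
    rcases min_cases (X' ω) (n : ℝ) with h1 | h1 <;> rcases min_cases (X ω) (n : ℝ) with h2 | h2 <;>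
      linarith
  have hDabs : ∀ n ω, ‖D n ω‖ ≤ ‖X' ω - X ω‖ := fun n ω => by
    simpa [D, Real.norm_eq_abs] using abs_min_sub_min_le_max (X' ω) n (X ω) n
  have hint : Integrable (fun ω => |Z ω| - (X' ω - X ω)) P := by
    have hnn : 0 ≤ᵐ[P] fun ω => |Z ω| - (X' ω - X ω) := by
      filter_upwards [hle] with ω hω
      exact sub_nonneg.2 (hω.trans (le_abs_self _))
    refine (lintegral_ofReal_ne_top_iff_integrable
      (hZ.abs.aestronglyMeasurable.sub (hX'.sub hX).aestronglyMeasurable) hnn).1 ?_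
    have h1 : ∀ᵐ ω ∂P, ENNReal.ofReal (|Z ω| - (X' ω - X ω))
        = Filter.liminf (fun n => ENNReal.ofReal (|Z ω| - D n ω)) Filter.atTop :=
      ae_of_all _ fun ω => (((ENNReal.continuous_ofReal.tendsto _).comp
        ((hlim ω).const_sub _)).liminf_eq).symm
    refine ne_of_eq_of_ne (lintegral_congr_ae h1) ?_
    refine ((lintegral_liminf_le' fun n =>
      (hZ.abs.aemeasurable.sub (hDm n).aemeasurable).ennreal_ofReal).trans ?_).trans_lt
        (ENNReal.ofReal_lt_top (r := ∫ ω, |Z ω| ∂P)) |>.ne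
    have h2 : ∀ n, ∫⁻ ω, ENNReal.ofReal (|Z ω| - D n ω) ∂P = ENNReal.ofReal (∫ ω, |Z ω| ∂P) := by
      intro n
      have h3 : 0 ≤ᵐ[P] fun ω => |Z ω| - D n ω := by
        filter_upwards [hDle] with ω hω
        exact sub_nonneg.2 (hω n)
      refine (ofReal_integral_eq_lintegral_ofReal (hZ.abs.sub (hDi n)) h3).symm.trans ?_
      rw [integral_sub' hZ.abs (hDi n), hD0, sub_zero]
    simp [h2]
  have hint : Integrable (fun ω => X' ω - X ω) P := by
    refine (hZ.abs.sub hint).congr (ae_of_all _ fun ω => ?_)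
    simp
  have hl := tendsto_integral_of_dominated_convergence _ (fun n => (hDm n).aestronglyMeasurable)
    hint.norm (fun n => ae_of_all _ (hDabs n)) (ae_of_all _ hlim)
  simp only [hD0] at hl
  exact ⟨hint, tendsto_nhds_unique hl tendsto_const_nhds⟩

/-! ### Stationary regime -/

theorem idleTime_nonneg {s : ZoneState} {ω : Cycle} (h1 : 0 < ω.nextArrival)
    (h2 : 0 < ω.retrialClock) : 0 ≤ idleTime s ω := by
  unfold idleTime retrialTime
  split_ifs
  · positivity
  · exact h1.le

theorem idleTime_le_nextArrival (s : ZoneState) (ω : Cycle) : idleTime s ω ≤ ω.nextArrival := by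
  unfold idleTime
  split_ifs with h
  · exact h.2.le
  · exact le_rfl

/-- A function with quadratic growth up to `n` and linear growth afterwards. -/
def huber (n x : ℝ) : ℝ := min x n * (2 * x - min x n)

theorem huber_nonneg {n x : ℝ} (hn : 0 ≤ n) (hx : 0 ≤ x) : 0 ≤ huber n x :=
  mul_nonneg (le_min hx hn) (by linarith [min_le_left x n])

/-- As a function of `x`, `huber n` has derivative 2 min(x, n), which is 2-Lipschitz; this is the
resulting Taylor bound. -/
theorem huber_sub_le (n x y : ℝ) :
    huber n y - huber n x ≤ 2 * min x n * (y - x) + (y - x) ^ 2 := by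
  unfold huber
  rcases min_cases x n with ⟨h1, h2⟩ | ⟨h1, h2⟩ <;> rcases min_cases y n with ⟨h3, h4⟩ | ⟨h3, h4⟩ <;>
    rw [h1, h3] <;> nlinarith [sq_nonneg (y - n), sq_nonneg (y - x)]

section Stationary

variable {lam θ : ℝ} (hlam : 0 < lam) (hθ : 0 < θ) {B : Measure ℝ} [IsProbabilityMeasure B]
  (hB : ∀ᵐ t ∂B, 0 ≤ t) (hB₂ : Integrable (fun t => t ^ 2) B)
  {μ : Measure ZoneState} (hμ : IsStationaryZoneLaw lam θ B μ)

omit [IsProbabilityMeasure B] in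
include hμ in
theorem ae_comp_nextState {p : ZoneState → Prop} (h : ∀ᵐ s ∂μ, p s) :
    ∀ᵐ x ∂μ.prod (cycleLaw lam θ B), p (nextState x.1 x.2) := by
  rw [← hμ.invariant] at h
  exact ae_of_ae_map measurable_nextState.aemeasurable h

include hlam hθ hμ in
theorem integral_increment_eq_zero {X : ZoneState → ℝ} (hX : Measurable X) (h0 : 0 ≤ᵐ[μ] X)
    {Z : ZoneState × Cycle → ℝ} (hZ : Integrable Z (μ.prod (cycleLaw lam θ B)))
    (hle : ∀ᵐ x ∂μ.prod (cycleLaw lam θ B), X (nextState x.1 x.2) - X x.1 ≤ Z x) :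
    Integrable (fun x : ZoneState × Cycle => X (nextState x.1 x.2) - X x.1)
        (μ.prod (cycleLaw lam θ B)) ∧
      ∫ x : ZoneState × Cycle, (X (nextState x.1 x.2) - X x.1) ∂μ.prod (cycleLaw lam θ B) = 0 := by
  have := hμ.isProbabilityMeasure
  have := isProbabilityMeasure_cycleLaw hlam hθ B
  refine integrable_sub_of_map_eq (X := fun x : ZoneState × Cycle => X x.1) (hX.comp measurable_fst)
    (hX.comp measurable_nextState) (Measure.quasiMeasurePreserving_fst.ae h0)
    (ae_comp_nextState hμ h0) ?_ hZ hle
  have h1 := Measure.map_map (μ := μ.prod (cycleLaw lam θ B)) hX measurable_nextState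
  have h2 := Measure.map_map (μ := μ.prod (cycleLaw lam θ B)) hX measurable_fst
  rw [hμ.invariant] at h1
  rw [Measure.map_fst_prod, measure_univ, one_smul] at h2
  exact h1.symm.trans h2

/-! ### Moments of arrivals and retrials. -/

include hlam hθ hB hB₂ in
theorem integrable_arrivals_and_integral :
    Integrable (fun ω => (ω.arrivals : ℝ)) (cycleLaw lam θ B) ∧
      ∫ ω, (ω.arrivals : ℝ) ∂cycleLaw lam θ B = lam * ∫ t, t ∂B := by
  have h : Integrable (fun t : ℝ => t) B :=
    ((memLp_two_iff_integrable_sq (by fun_prop)).2 hB₂).integrable one_le_two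
  simpa using integrable_descFactorial_arrivals_and_integral hlam hθ B hB 1 (by simpa using h)

include hlam hθ hB hB₂ in
theorem integrable_arrivals_sq_and_integral :
    Integrable (fun ω => (ω.arrivals : ℝ) ^ 2) (cycleLaw lam θ B) ∧
      ∫ ω, (ω.arrivals : ℝ) ^ 2 ∂cycleLaw lam θ B
        = lam ^ 2 * (∫ t, t ^ 2 ∂B) + lam * ∫ t, t ∂B := by
  obtain ⟨h1, h1'⟩ := integrable_arrivals_and_integral hlam hθ hB hB₂
  obtain ⟨h2, h2'⟩ := integrable_descFactorial_arrivals_and_integral hlam hθ B hB 2 hB₂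
  have h : ∀ n : ℕ, (n : ℝ) ^ 2 = (n.descFactorial 2 : ℝ) + n := by
    intro n
    rcases n with _ | n
    · simp
    · simp [Nat.descFactorial]
      ring
  simp_rw [h]
  exact ⟨h2.add h1, by rw [integral_add h2 h1, h1', h2']⟩

include hlam hθ in
theorem integral_mul_retryInd [IsProbabilityMeasure μ] {h : ZoneState → ℝ} (hh : Integrable h μ) :
    Integrable (fun x : ZoneState × Cycle => h x.1 * retryInd x.1 x.2)
        (μ.prod (cycleLaw lam θ B)) ∧
      ∫ x : ZoneState × Cycle, h x.1 * retryInd x.1 x.2 ∂μ.prod (cycleLaw lam θ B)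
        = ∫ s, h s * retryProb lam θ s.1 ∂μ := by
  have := isProbabilityMeasure_cycleLaw hlam hθ B
  have hi : Integrable (fun x : ZoneState × Cycle => h x.1 * retryInd x.1 x.2)
      (μ.prod (cycleLaw lam θ B)) := by
    refine (hh.comp_fst (cycleLaw lam θ B)).mono
      ((hh.comp_fst _).aestronglyMeasurable.mul measurable_retryInd.aestronglyMeasurable)
      (ae_of_all _ fun x => ?_)
    rw [norm_mul, Real.norm_of_nonneg (retryInd_nonneg _ _)]
    exact mul_le_of_le_one_right (norm_nonneg _) (retryInd_le_one _ _)
  refine ⟨hi, ?_⟩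
  rw [integral_prod _ hi]
  simp_rw [integral_const_mul, integral_retryInd hlam hθ B]

include hlam hθ in
theorem integrable_retryProb [IsProbabilityMeasure μ] :
    Integrable (fun s : ZoneState => retryProb lam θ s.1) μ := by
  have h : Measurable fun s : ZoneState => retryProb lam θ s.1 :=
    (measurable_from_nat (f := retryProb lam θ)).comp measurable_fst
  refine Integrable.of_bound (C := 1) h.aestronglyMeasurable (ae_of_all _ fun s => ?_)
  rw [Real.norm_of_nonneg (retryProb_nonneg hlam hθ _)]
  exact retryProb_le_one hlam hθ _

include hlam hθ in
theorem integral_retryInd_prod [IsProbabilityMeasure μ] :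
    Integrable (fun x : ZoneState × Cycle => retryInd x.1 x.2) (μ.prod (cycleLaw lam θ B)) ∧
      ∫ x : ZoneState × Cycle, retryInd x.1 x.2 ∂μ.prod (cycleLaw lam θ B)
        = ∫ s, retryProb lam θ s.1 ∂μ := by
  simpa using integral_mul_retryInd hlam hθ (B := B) (μ := μ) (integrable_const (1 : ℝ))

include hlam hθ in
/-- In the mean, a retrial is independent of the service and of the arrivals during it. -/
theorem integral_retryInd_mul_prod [IsProbabilityMeasure μ] {h : ℝ × (ℕ → ℝ) → ℝ}
    (hm : Measurable h) (hh : Integrable (fun ω : Cycle => h ω.2.2.2) (cycleLaw lam θ B)) :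
    Integrable (fun x : ZoneState × Cycle => retryInd x.1 x.2 * h x.2.2.2.2)
        (μ.prod (cycleLaw lam θ B)) ∧
      ∫ x : ZoneState × Cycle, retryInd x.1 x.2 * h x.2.2.2.2 ∂μ.prod (cycleLaw lam θ B)
        = (∫ s, retryProb lam θ s.1 ∂μ) * ∫ ω : Cycle, h ω.2.2.2 ∂cycleLaw lam θ B := by
  have := isProbabilityMeasure_cycleLaw hlam hθ B
  have hi : Integrable (fun x : ZoneState × Cycle => retryInd x.1 x.2 * h x.2.2.2.2)
      (μ.prod (cycleLaw lam θ B)) := by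
    refine (hh.comp_snd μ).mono
      (measurable_retryInd.aestronglyMeasurable.mul (hh.comp_snd _).aestronglyMeasurable)
      (ae_of_all _ fun x => ?_)
    rw [norm_mul, Real.norm_of_nonneg (retryInd_nonneg _ _)]
    exact mul_le_of_le_one_left (norm_nonneg _) (retryInd_le_one _ _)
  refine ⟨hi, ?_⟩
  rw [integral_prod _ hi]
  simp_rw [integral_retryInd_mul hlam hθ B _ hm, integral_mul_const]

include hlam hθ hB hB₂ hμ in
/-- In a stationary regime, the server is as often taken by waiting trucks as trucks arrive. -/
theorem integral_retryProb : ∫ s, retryProb lam θ s.1 ∂μ = lam * ∫ t, t ∂B := by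
  have := hμ.isProbabilityMeasure
  have := isProbabilityMeasure_cycleLaw hlam hθ B
  obtain ⟨hA, hA'⟩ := integrable_arrivals_and_integral hlam hθ hB hB₂
  obtain ⟨hd, hd'⟩ := integral_retryInd_prod hlam hθ (B := B) (μ := μ)
  have hi := (hA.comp_snd μ).sub' hd
  have h := (integral_increment_eq_zero hlam hθ hμ (X := fun s => (s.1 : ℝ)) (by fun_prop)
    (ae_of_all _ fun s => Nat.cast_nonneg _) hi
    (ae_of_all _ fun x => le_of_eq (by
      rw [nextState_fst_cast]; ring))).2
  have h2 : ∀ x : ZoneState × Cycle, ((nextState x.1 x.2).1 : ℝ) - x.1.1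
      = x.2.arrivals - retryInd x.1 x.2 := fun x => by rw [nextState_fst_cast]; ring
  simp_rw [h2] at h
  rw [integral_sub (hA.comp_snd μ) hd, hd',
    integral_fun_snd (fun ω : Cycle => (ω.arrivals : ℝ)), hA'] at h
  simp at h
  linarith

include hlam hθ hB hB₂ in
-- Since δ² = δ, the square is A² - 2δA + δ, and A is independent of δ.
theorem integrable_increment_sq_and_integral [IsProbabilityMeasure μ]
    (hr : ∫ s, retryProb lam θ s.1 ∂μ = lam * ∫ t, t ∂B) :
    Integrable (fun x : ZoneState × Cycle => ((x.2.arrivals : ℝ) - retryInd x.1 x.2) ^ 2)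
        (μ.prod (cycleLaw lam θ B)) ∧
      ∫ x : ZoneState × Cycle, ((x.2.arrivals : ℝ) - retryInd x.1 x.2) ^ 2
        ∂μ.prod (cycleLaw lam θ B)
        = lam ^ 2 * (∫ t, t ^ 2 ∂B) + 2 * (lam * ∫ t, t ∂B) - 2 * (lam * ∫ t, t ∂B) ^ 2 := by
  have := isProbabilityMeasure_cycleLaw hlam hθ B
  obtain ⟨hA, hA'⟩ := integrable_arrivals_and_integral hlam hθ hB hB₂
  obtain ⟨hA2, hA2'⟩ := integrable_arrivals_sq_and_integral hlam hθ hB hB₂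
  obtain ⟨hd, hd'⟩ := integral_retryInd_prod hlam hθ (B := B) (μ := μ)
  have hm : Measurable fun x : ℝ × (ℕ → ℝ) => (arrivalCount x.1 x.2 : ℝ) := by fun_prop
  obtain ⟨hAd, hAd'⟩ := integral_retryInd_mul_prod hlam hθ (μ := μ) hm hA
  have h : ∀ x : ZoneState × Cycle, ((x.2.arrivals : ℝ) - retryInd x.1 x.2) ^ 2
      = (x.2.arrivals : ℝ) ^ 2 - 2 * (retryInd x.1 x.2 * arrivalCount x.2.2.2.2.1 x.2.2.2.2.2)
        + retryInd x.1 x.2 := by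
    intro x
    rw [← Cycle.arrivals_eq, sub_sq, sq (retryInd x.1 x.2), retryInd_mul_self]
    ring
  simp_rw [h]
  have hA2s := hA2.comp_snd μ
  refine ⟨(hA2s.sub' (hAd.const_mul 2)).fun_add hd, ?_⟩
  rw [integral_add (hA2s.sub' (hAd.const_mul 2)) hd, integral_sub hA2s (hAd.const_mul 2),
    integral_const_mul, hd', hAd', integral_fun_snd (fun ω : Cycle => (ω.arrivals : ℝ) ^ 2), hA2',
    hr]
  simp_rw [← Cycle.arrivals_eq]
  rw [hA']
  simp
  ring

include hlam hθ in
-- This identity closes the second-moment equation: it makes the defect `k - k * retryProb lam θ k`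
-- bounded and of known mean.
theorem mul_one_sub_retryProb (k : ℕ) :
    k * (1 - retryProb lam θ k) = lam / θ * retryProb lam θ k := by
  have := rate_pos hlam hθ k
  rw [one_sub_retryProb hlam hθ, retryProb]
  field_simp

include hlam hθ hB hB₂ hμ in
-- The square is replaced by `huber n`, whose increment has an integrable upper bound without any
-- moment of N. The resulting bound on E min(N, n) is uniform in `n`, and Fatou concludes.
theorem integrable_waiting (hρ : lam * ∫ t, t ∂B < 1) :
    Integrable (fun s : ZoneState => (s.1 : ℝ)) μ := by
  have := hμ.isProbabilityMeasure
  have := isProbabilityMeasure_cycleLaw hlam hθ B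
  obtain ⟨hA, hA'⟩ := integrable_arrivals_and_integral hlam hθ hB hB₂
  have hr := integral_retryProb hlam hθ hB hB₂ hμ
  obtain ⟨hu, -⟩ := integrable_increment_sq_and_integral hlam hθ hB hB₂ hr
  set ρ := lam * ∫ t, t ∂B with hρ_def
  set C := ∫ x : ZoneState × Cycle, ((x.2.arrivals : ℝ) - retryInd x.1 x.2) ^ 2
    ∂μ.prod (cycleLaw lam θ B) with hC
  have hmin : ∀ n : ℕ, Integrable (fun s : ZoneState => min (s.1 : ℝ) n) μ := fun n =>
    Integrable.of_bound (C := n) (by fun_prop) (ae_of_all _ fun s => by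
      rw [Real.norm_of_nonneg (by positivity)]; exact min_le_right _ _)
  -- With m = E min(N, n), the drift gives 0 ≤ 2(ρm - E[min(N, n)δ]) + C, and
  -- `mul_one_sub_retryProb` gives E[min(N, n)δ] ≥ m - λ/θ. Together these read (1 - ρ)m ≤ C/2 +
  -- λ/θ.
  have hbound : ∀ n : ℕ, ∫ s : ZoneState, min (s.1 : ℝ) n ∂μ ≤ (C / 2 + lam / θ) / (1 - ρ) := by
    intro n
    obtain ⟨hd, hd'⟩ := integral_mul_retryInd hlam hθ (B := B) (hmin n)
    have hkA := (hmin n).mul_prod hA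
    have hi : Integrable (fun x : ZoneState × Cycle =>
        2 * (min (x.1.1 : ℝ) n * x.2.arrivals - min (x.1.1 : ℝ) n * retryInd x.1 x.2)
          + ((x.2.arrivals : ℝ) - retryInd x.1 x.2) ^ 2) (μ.prod (cycleLaw lam θ B)) :=
      ((hkA.sub' hd).const_mul 2).fun_add hu
    have hle : ∀ x : ZoneState × Cycle, huber n (nextState x.1 x.2).1 - huber n x.1.1 ≤
        2 * (min (x.1.1 : ℝ) n * x.2.arrivals - min (x.1.1 : ℝ) n * retryInd x.1 x.2)
          + ((x.2.arrivals : ℝ) - retryInd x.1 x.2) ^ 2 := by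
      intro x
      refine (huber_sub_le _ _ _).trans (le_of_eq ?_)
      rw [nextState_fst_cast]
      ring
    obtain ⟨h1, h2⟩ := integral_increment_eq_zero hlam hθ hμ
      (X := fun s => huber n s.1) (by unfold huber; fun_prop)
      (ae_of_all _ fun s => huber_nonneg (Nat.cast_nonneg _) (Nat.cast_nonneg _)) hi
      (ae_of_all _ hle)
    have h3 := integral_mono h1 hi hle
    rw [h2, integral_add ((hkA.sub' hd).const_mul 2) hu, integral_const_mul,
      integral_sub hkA hd, hd', integral_prod_mul (fun s : ZoneState => min (s.1 : ℝ) n)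
        (fun ω : Cycle => (ω.arrivals : ℝ)), hA', ← hC] at h3
    have hb : Integrable (fun s : ZoneState => min (s.1 : ℝ) n * retryProb lam θ s.1) μ := by
      refine (hmin n).mono ((hmin n).aestronglyMeasurable.mul
        (integrable_retryProb hlam hθ).aestronglyMeasurable) (ae_of_all _ fun s => ?_)
      rw [norm_mul, Real.norm_of_nonneg (retryProb_nonneg hlam hθ _)]
      exact mul_le_of_le_one_right (norm_nonneg _) (retryProb_le_one hlam hθ _)
    have h4 : ∫ s : ZoneState, min (s.1 : ℝ) n ∂μ
        ≤ ∫ s : ZoneState, (min (s.1 : ℝ) n * retryProb lam θ s.1 + lam / θ) ∂μ := by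
      refine integral_mono (hmin n) (hb.fun_add (integrable_const _)) fun s => ?_
      have h5 := mul_one_sub_retryProb hlam hθ s.1
      have h6 := retryProb_le_one hlam hθ s.1
      have h7 : min (s.1 : ℝ) n * (1 - retryProb lam θ s.1) ≤ s.1 * (1 - retryProb lam θ s.1) :=
        mul_le_mul_of_nonneg_right (min_le_left _ _) (by linarith)
      have h8 : lam / θ * retryProb lam θ s.1 ≤ lam / θ :=
        mul_le_of_le_one_right (by positivity) h6
      dsimp only
      linarith
    rw [integral_add hb (integrable_const _), integral_const] at h4
    simp at h4
    rw [le_div_iff₀ (by linarith)]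
    linarith
  have h0 : ∀ s : ZoneState, (0 : ℝ) ≤ s.1 := fun s => Nat.cast_nonneg _
  refine (lintegral_ofReal_ne_top_iff_integrable (by fun_prop) (ae_of_all _ h0)).1 ?_
  have h1 : ∀ s : ZoneState, ENNReal.ofReal (s.1 : ℝ)
      = Filter.liminf (fun n : ℕ => ENNReal.ofReal (min (s.1 : ℝ) n)) Filter.atTop := by
    intro s
    refine (Filter.Tendsto.liminf_eq (tendsto_const_nhds.congr' ?_)).symm
    filter_upwards [Filter.eventually_ge_atTop s.1] with n hn
    rw [min_eq_left (by exact_mod_cast hn)]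
  simp_rw [h1]
  refine ((lintegral_liminf_le fun n => by fun_prop).trans ?_).trans_lt
    (ENNReal.ofReal_lt_top (r := (C / 2 + lam / θ) / (1 - ρ))) |>.ne
  refine Filter.liminf_le_of_frequently_le' (Filter.Frequently.of_forall fun n => ?_)
  rw [← ofReal_integral_eq_lintegral_ofReal (hmin n) (ae_of_all _ fun s => by positivity)]
  exact ENNReal.ofReal_le_ofReal (hbound n)

include hlam hθ hB hB₂ hμ in
/-- The mean number of waiting trucks. -/
theorem integral_waiting (hρ : lam * ∫ t, t ∂B < 1) :
    ∫ s : ZoneState, (s.1 : ℝ) ∂μ = lam * (∫ t, t ∂B)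
      + lam * (lam * ∫ t, t ∂B) / (θ * (1 - lam * ∫ t, t ∂B))
      + lam ^ 2 * (∫ t, t ^ 2 ∂B) / (2 * (1 - lam * ∫ t, t ∂B)) := by
  have := hμ.isProbabilityMeasure
  have := isProbabilityMeasure_cycleLaw hlam hθ B
  have hN := integrable_waiting hlam hθ hB hB₂ hμ hρ
  obtain ⟨hA, hA'⟩ := integrable_arrivals_and_integral hlam hθ hB hB₂
  have hr := integral_retryProb hlam hθ hB hB₂ hμ
  obtain ⟨hu, hu'⟩ := integrable_increment_sq_and_integral hlam hθ hB hB₂ hr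
  obtain ⟨hd, hd'⟩ := integral_mul_retryInd hlam hθ (B := B) hN
  have hkA := hN.mul_prod hA
  have heq : ∀ x : ZoneState × Cycle, ((nextState x.1 x.2).1 : ℝ) ^ 2 - (x.1.1 : ℝ) ^ 2
      = 2 * ((x.1.1 : ℝ) * x.2.arrivals - x.1.1 * retryInd x.1 x.2)
          + ((x.2.arrivals : ℝ) - retryInd x.1 x.2) ^ 2 := by
    intro x
    rw [nextState_fst_cast]
    ring
  -- The increment of N² is affine in N, so a finite first moment suffices; N² need not be
  -- integrable.
  have h2 := (integral_increment_eq_zero hlam hθ hμ (X := fun s => (s.1 : ℝ) ^ 2) (by fun_prop)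
    (ae_of_all _ fun s => by positivity) (((hkA.sub' hd).const_mul 2).fun_add hu)
    (ae_of_all _ fun x => (heq x).le)).2
  simp_rw [heq] at h2
  rw [integral_add ((hkA.sub' hd).const_mul 2) hu, integral_const_mul,
      integral_sub hkA hd, hd', integral_prod_mul (fun s : ZoneState => (s.1 : ℝ))
        (fun ω : Cycle => (ω.arrivals : ℝ)), hA', hu'] at h2
  have h3 : ∀ s : ZoneState, (s.1 : ℝ) * retryProb lam θ s.1
      = s.1 - lam / θ * retryProb lam θ s.1 := fun s => by
    rw [← mul_one_sub_retryProb hlam hθ]; ring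
  simp_rw [h3] at h2
  rw [integral_sub hN ((integrable_retryProb hlam hθ).const_mul _), integral_const_mul, hr] at h2
  have h1 : 1 - lam * ∫ t, t ∂B ≠ 0 := by linarith
  generalize (∫ t, t ∂B) = b1 at *
  generalize (∫ t, t ^ 2 ∂B) = b2 at *
  generalize (∫ s : ZoneState, (s.1 : ℝ) ∂μ) = N at *
  field_simp at h2 ⊢
  linarith

include hlam hθ hB hB₂ hμ in
/-- The mean sojourn time. -/
theorem integral_sojournTime (hρ : lam * ∫ t, t ∂B < 1) :
    Integrable (fun x : ZoneState × Cycle => sojournTime x.1 x.2) (μ.prod (cycleLaw lam θ B)) ∧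
      ∫ x : ZoneState × Cycle, sojournTime x.1 x.2 ∂μ.prod (cycleLaw lam θ B)
        = (∫ t, t ∂B) + lam * (∫ t, t ^ 2 ∂B) / (2 * (1 - lam * ∫ t, t ∂B))
          + lam * (∫ t, t ∂B) / (θ * (1 - lam * ∫ t, t ∂B)) := by
  have := hμ.isProbabilityMeasure
  have := isProbabilityMeasure_cycleLaw hlam hθ B
  have hN := integrable_waiting hlam hθ hB hB₂ hμ hρ
  have hN' := integral_waiting hlam hθ hB hB₂ hμ hρ
  have hr := integral_retryProb hlam hθ hB hB₂ hμ
  have hV0 : Integrable (fun t : ℝ => t) B :=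
    ((memLp_two_iff_integrable_sq (by fun_prop)).2 hB₂).integrable one_le_two
  have hV : Integrable (fun ω : Cycle => ω.service) (cycleLaw lam θ B) :=
    (measurePreserving_service hlam hθ B).integrable_comp_of_integrable hV0
  have hV' : ∫ ω : Cycle, ω.service ∂cycleLaw lam θ B = ∫ t, t ∂B := by
    have h := integral_map (μ := cycleLaw lam θ B) measurable_service.aemeasurable
      (f := fun t : ℝ => t) (by fun_prop)
    rw [(measurePreserving_service hlam hθ B).map_eq] at h
    exact h.symm
  obtain ⟨hR, hR'⟩ := integrable_newAge_and_integral hlam hθ B hB hB₂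
  obtain ⟨hdV, hdV'⟩ := integral_retryInd_mul_prod hlam hθ (μ := μ)
    (h := fun y : ℝ × (ℕ → ℝ) => y.1) measurable_fst hV
  have hcyc := Measure.quasiMeasurePreserving_snd (μ := μ) |>.ae (ae_cycle hlam hθ B hB)
  -- In an empty zone the idle time is the time to the next arrival.
  have hE : Integrable (fun ω : Cycle => ω.nextArrival) (cycleLaw lam θ B) := by
    refine (integrable_idleTime_and_integral hlam hθ B (0, 0)).1.congr (ae_of_all _ fun ω => ?_)
    simp [idleTime, Retries]
  have hkI : Integrable (fun x : ZoneState × Cycle => (x.1.1 : ℝ) * idleTime x.1 x.2)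
      (μ.prod (cycleLaw lam θ B)) := by
    refine (hN.mul_prod hE).mono (by fun_prop) ?_
    filter_upwards [hcyc] with x hx
    have h1 := idleTime_nonneg (s := x.1) hx.1 hx.2.1
    have h2 := idleTime_le_nextArrival x.1 x.2
    rw [Real.norm_of_nonneg (by positivity), Real.norm_of_nonneg (mul_nonneg (by positivity) hx.1.le)]
    gcongr
  -- Given N = k, the mean of kI is k/(λ + kθ), the retrial probability divided by θ; its mean is
  -- ρ/θ.
  have hkI' : ∫ x : ZoneState × Cycle, (x.1.1 : ℝ) * idleTime x.1 x.2 ∂μ.prod (cycleLaw lam θ B)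
      = lam * (∫ t, t ∂B) / θ := by
    rw [integral_prod _ hkI]
    simp_rw [integral_const_mul, (integrable_idleTime_and_integral hlam hθ B _).2]
    have h : ∀ s : ZoneState, (s.1 : ℝ) * (1 / (lam + s.1 * θ)) = retryProb lam θ s.1 / θ := by
      intro s
      have := rate_pos hlam hθ s.1
      unfold retryProb
      field_simp
    simp_rw [h]
    rw [integral_div, hr]
  have hkV := hN.mul_prod hV
  have hRs := hR.comp_snd μ
  have hVs := hV.comp_snd μ
  have hZ := ((hkI.fun_add hkV).fun_add hRs).fun_add (hVs.sub' hdV)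
  have hid : ∀ᵐ x ∂μ.prod (cycleLaw lam θ B),
      totalAge (nextState x.1 x.2) - totalAge x.1 + sojournTime x.1 x.2
        = (x.1.1 : ℝ) * idleTime x.1 x.2 + x.1.1 * x.2.service
          + newAge x.2.2.2.2.1 x.2.2.2.2.2 + (x.2.service - retryInd x.1 x.2 * x.2.2.2.2.1) := by
    filter_upwards [hcyc] with x hx
    have h := totalAge_nextState x.1 hx.2.2.1.1 hx.2.2.1.2
    have h2 : x.2.2.2.2.1 = x.2.service := rfl
    rw [h2] at h ⊢
    linarith
  have hW : ∀ᵐ x ∂μ.prod (cycleLaw lam θ B), 0 ≤ sojournTime x.1 x.2 := by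
    filter_upwards [hcyc, Measure.quasiMeasurePreserving_fst.ae hμ.nonneg] with x hx hs
    unfold sojournTime
    split_ifs with h
    · have := hs _ (selected_lt h.1 hx.2.2.1.1 hx.2.2.1.2)
      have := idleTime_nonneg (s := x.1) hx.1 hx.2.1
      have := hx.2.2.2.1
      positivity
    · exact hx.2.2.2.1
  -- Because the sojourn time is nonnegative, the age balance bounds the increment of the total age
  -- above by an integrable variable. The sojourn time is then recovered as that variable minus the
  -- increment.
  obtain ⟨hT, hT'⟩ := integral_increment_eq_zero hlam hθ hμ measurable_totalAge
    (by
      filter_upwards [hμ.nonneg] with s hs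
      exact Finset.sum_nonneg fun i hi => hs i (Finset.mem_range.1 hi)) hZ
    (by
      filter_upwards [hid, hW] with x h1 h2
      linarith)
  have hWeq : (fun x : ZoneState × Cycle => sojournTime x.1 x.2) =ᵐ[μ.prod (cycleLaw lam θ B)]
      fun x => ((x.1.1 : ℝ) * idleTime x.1 x.2 + x.1.1 * x.2.service
          + newAge x.2.2.2.2.1 x.2.2.2.2.2 + (x.2.service - retryInd x.1 x.2 * x.2.2.2.2.1))
          - (totalAge (nextState x.1 x.2) - totalAge x.1) := by
    filter_upwards [hid] with x h1
    linarith
  refine ⟨(hZ.sub' hT).congr hWeq.symm, ?_⟩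
  rw [integral_congr_ae hWeq, integral_sub hZ hT, hT', integral_add ((hkI.fun_add hkV).fun_add hRs)
    (hVs.sub' hdV), integral_add (hkI.fun_add hkV) hRs, integral_add hkI hkV, integral_sub hVs hdV,
    hkI', hdV', integral_prod_mul (fun s : ZoneState => (s.1 : ℝ)) (fun ω : Cycle => ω.service),
    integral_fun_snd (fun ω : Cycle => newAge ω.2.2.2.1 ω.2.2.2.2),
    integral_fun_snd (fun ω : Cycle => ω.service), hR', hV', hr, hN']
  have hV'' : ∫ ω : Cycle, ω.2.2.2.1 ∂cycleLaw lam θ B = ∫ t, t ∂B := hV'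
  rw [hV'']
  have h1 : 1 - lam * ∫ t, t ∂B ≠ 0 := by linarith
  generalize (∫ t, t ∂B) = b1 at *
  generalize (∫ t, t ^ 2 ∂B) = b2 at *
  simp
  field_simp
  ring

end Stationary

/-! ### The embedded chain -/

section Chain

variable {lam θ : ℝ} (hlam : 0 < lam) (hθ : 0 < θ) {B : Measure ℝ} [IsProbabilityMeasure B]
  (hB : ∀ᵐ t ∂B, 0 ≤ t)

include hlam hB in
theorem arrivalProb_zero_pos : 0 < arrivalProb lam B 0 := by
  have h : Integrable (fun t => Real.exp (-(lam * t))) B := by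
    refine Integrable.of_bound (C := 1) (by fun_prop) ?_
    filter_upwards [hB] with t ht
    rw [Real.norm_of_nonneg (Real.exp_pos _).le, Real.exp_le_one_iff]
    have : 0 ≤ lam * t := by positivity
    linarith
  simpa [arrivalProb] using integral_exp_pos h

omit [IsProbabilityMeasure B] in
theorem transProb_eq_zero {k j : ℕ} (h : j + 1 < k) : transProb lam θ B k j = 0 := by
  rw [transProb, if_neg (by omega), if_neg (by omega)]
  simp

include hlam hθ hB in
theorem transProb_succ_pos (j : ℕ) : 0 < transProb lam θ B (j + 1) j := by
  have h := arrivalProb_zero_pos hlam hB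
  have h2 := rate_pos hlam hθ (j + 1)
  rw [transProb, if_neg (by omega), if_pos le_rfl, Nat.sub_self]
  have : 0 < ((j + 1 : ℕ) : ℝ) * θ := by positivity
  positivity

include hlam hθ hB in
-- Equation `j` involves only `d 0, …, d (j + 1)`, the last with a positive coefficient, so the
-- solution propagates upwards from `d 0`. No sign condition on `d` is imposed, so differences of
-- laws are allowed.
theorem eq_zero_of_invariant {d : ℕ → ℝ}
    (hd : ∀ j, d j = ∑ k ∈ Finset.range (j + 2), d k * transProb lam θ B k j) (h0 : d 0 = 0)
    (k : ℕ) : d k = 0 := by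
  induction k using Nat.strong_induction_on with
  | _ k ih =>
    rcases k with _ | j
    · exact h0
    · have h := hd j
      rw [Finset.sum_range_succ, ih j (Nat.lt_succ_self j), Finset.sum_eq_zero fun i hi => by
        rw [ih i (Finset.mem_range.1 hi), zero_mul], zero_add] at h
      exact (mul_eq_zero.1 h.symm).resolve_right (transProb_succ_pos hlam hθ hB j).ne'

omit [IsProbabilityMeasure B] in
theorem IsStationaryLaw.eq_sum {p : ℕ → ℝ} (hp : IsStationaryLaw lam θ B p) (j : ℕ) :
    p j = ∑ k ∈ Finset.range (j + 2), p k * transProb lam θ B k j :=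
  (hp.invariant j).unique (hasSum_sum_of_ne_finset_zero fun k hk => by
    rw [transProb_eq_zero (by simpa [Nat.succ_le_iff] using hk), mul_zero])

include hlam hθ hB in
/-- The embedded chain has at most one stationary law. -/
theorem IsStationaryLaw.unique {p p' : ℕ → ℝ} (hp : IsStationaryLaw lam θ B p)
    (hp' : IsStationaryLaw lam θ B p') : p' = p := by
  have h0 : p 0 ≠ 0 := by
    intro h
    have h1 : p = 0 := funext (eq_zero_of_invariant hlam hθ hB hp.eq_sum h)
    have h2 := hp.total
    rw [h1] at h2
    exact zero_ne_one (hasSum_zero.unique h2)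
  -- This combination solves the same linear equations and vanishes at 0.
  have h : ∀ k, p 0 * p' k - p' 0 * p k = 0 := by
    refine eq_zero_of_invariant hlam hθ hB (fun j => ?_) (by ring)
    rw [hp.eq_sum j, hp'.eq_sum j, Finset.mul_sum, Finset.mul_sum, ← Finset.sum_sub_distrib]
    exact Finset.sum_congr rfl fun k _ => by ring
  have h1 : p 0 = p' 0 := by
    have h2 := (hp'.total.mul_left (p 0)).sub (hp.total.mul_left (p' 0))
    simp only [h, mul_one] at h2
    linarith [hasSum_zero.unique h2]
  funext k
  have h2 := h k
  rw [← h1, ← mul_sub] at h2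
  exact sub_eq_zero.1 ((mul_eq_zero.1 h2).resolve_left h0)

include hlam hθ hB in
-- Splits on whether a retrial occurs, which is independent of the arrivals during the service; the
-- ages in `s` play no role.
theorem cycleLaw_real_nextState_fst_eq (s : ZoneState) (j : ℕ) :
    (cycleLaw lam θ B).real {ω | (nextState s ω).1 = j} = transProb lam θ B s.1 j := by
  have := isProbabilityMeasure_cycleLaw hlam hθ B
  have hR := measurableSet_retries_right s
  have hA : ∀ m, (cycleLaw lam θ B).real {ω | s.1 + ω.arrivals = m}
      = if s.1 ≤ m then arrivalProb lam B (m - s.1) else 0 := by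
    intro m
    split_ifs with h
    · rw [← cycleLaw_real_arrivals_eq hlam hθ B hB]
      congr 1
      ext ω
      simp only [Set.mem_ofPred_eq]
      omega
    · rw [← measureReal_empty (μ := cycleLaw lam θ B)]
      congr 1
      ext ω
      refine iff_of_false (fun hω => ?_) (Set.notMem_empty ω)
      have hω : s.1 + ω.arrivals = m := hω
      omega
  have hS : ∀ m, MeasurableSet {x : ℝ × (ℕ → ℝ) | s.1 + arrivalCount x.1 x.2 = m} := fun m =>
    (measurable_const.add measurable_arrivalCount) (measurableSet_singleton m)
  have hind : ∀ (c : ℝ) (m : ℕ),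
      (cycleLaw lam θ B).real ({ω | retryInd s ω = c} ∩ {ω | s.1 + ω.arrivals = m})
      = (cycleLaw lam θ B).real {ω | retryInd s ω = c}
        * (cycleLaw lam θ B).real {ω | s.1 + ω.arrivals = m} := by
    intro c m
    have h := (indepFun_retryInd_service_gaps hlam hθ B s).measure_inter_preimage_eq_mul {c} _
      (measurableSet_singleton c) (hS m)
    simp only [measureReal_def]
    rw [← ENNReal.toReal_mul]
    exact congrArg ENNReal.toReal h
  have h1 : {ω | retryInd s ω = 1} = {ω | Retries s ω} := by
    ext ω
    by_cases h : Retries s ω <;> simp [retryInd, h]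
  have h0 : {ω | retryInd s ω = 0} = {ω | ¬ Retries s ω} := by
    ext ω
    by_cases h : Retries s ω <;> simp [retryInd, h]
  have e1 : {ω | (nextState s ω).1 = j} ∩ {ω | Retries s ω}
      = {ω | Retries s ω} ∩ {ω | s.1 + ω.arrivals = j + 1} := by
    ext ω
    simp only [Set.mem_inter_iff, Set.mem_ofPred_eq, nextState_fst]
    rw [and_comm]
    refine and_congr_right fun h => ?_
    have := h.1
    simp only [remaining, h, if_true]
    omega
  have e0 : {ω | (nextState s ω).1 = j} \ {ω | Retries s ω}
      = {ω | ¬ Retries s ω} ∩ {ω | s.1 + ω.arrivals = j} := by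
    ext ω
    simp only [Set.mem_inter_iff, Set.mem_sdiff, Set.mem_ofPred_eq, nextState_fst]
    rw [and_comm]
    refine and_congr_right fun h => ?_
    simp only [remaining, h, if_false]
  rw [← measureReal_inter_add_sdiff (s := {ω | (nextState s ω).1 = j}) hR, e1, e0, ← h1, ← h0,
    hind, hind, h1, h0, hA, hA, cycleLaw_real_retries hlam hθ B,
    cycleLaw_real_not_retries hlam hθ B, transProb, retryProb]
  ring

theorem hasSum_marginal {μ : Measure ZoneState} {g : ℕ → ℝ}
    (hg : Integrable (fun s : ZoneState => g s.1) μ) :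
    HasSum (fun k => μ.real {s | s.1 = k} * g k) (∫ s, g s.1 ∂μ) := by
  have hS : ∀ k, MeasurableSet {s : ZoneState | s.1 = k} := fun k =>
    measurable_fst (measurableSet_singleton k)
  have hU : ⋃ k, {s : ZoneState | s.1 = k} = Set.univ := by
    ext s
    simp
  have h := hasSum_integral_iUnion (μ := μ) (f := fun s : ZoneState => g s.1) hS
    (fun i j hij => Set.disjoint_left.2 fun s hi hj => hij (Eq.trans (Eq.symm hi) hj))
    hg.integrableOn
  rw [hU, Measure.restrict_univ] at h
  refine h.congr_fun fun k => ?_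
  rw [setIntegral_congr_fun (g := fun _ => g k) (hS k) fun s hs => congrArg g hs,
    setIntegral_const, smul_eq_mul]

include hlam hθ hB in
/-- Under a stationary law of the zone, the number of waiting trucks is stationary for the embedded
chain. -/
theorem IsStationaryZoneLaw.isStationaryLaw {μ : Measure ZoneState}
    (hμ : IsStationaryZoneLaw lam θ B μ) :
    IsStationaryLaw lam θ B fun k => μ.real {s | s.1 = k} := by
  have := hμ.isProbabilityMeasure
  have := isProbabilityMeasure_cycleLaw hlam hθ B
  refine ⟨fun k => measureReal_nonneg, ?_, fun j => ?_⟩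
  · simpa using hasSum_marginal (μ := μ) (g := fun _ => 1) (integrable_const _)
  · have hS : MeasurableSet {s : ZoneState | s.1 = j} := measurable_fst (measurableSet_singleton j)
    have hS' : MeasurableSet {x : ZoneState × Cycle | (nextState x.1 x.2).1 = j} :=
      measurable_nextState hS
    have hi : Integrable ({x : ZoneState × Cycle | (nextState x.1 x.2).1 = j}.indicator
        (1 : ZoneState × Cycle → ℝ)) (μ.prod (cycleLaw lam θ B)) :=
      (integrable_const (1 : ℝ)).indicator hS'
    have h1 : ∀ s : ZoneState, ∫ ω, {x : ZoneState × Cycle | (nextState x.1 x.2).1 = j}.indicator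
        (1 : ZoneState × Cycle → ℝ) (s, ω) ∂cycleLaw lam θ B = transProb lam θ B s.1 j := by
      intro s
      have hSs : MeasurableSet {ω | (nextState s ω).1 = j} := measurable_prodMk_left hS'
      rw [← cycleLaw_real_nextState_fst_eq hlam hθ hB s j, ← integral_indicator_one hSs]
      rfl
    have h2 : μ.real {s | s.1 = j} = ∫ s : ZoneState, transProb lam θ B s.1 j ∂μ := by
      simp_rw [← h1]
      rw [← integral_prod _ hi, integral_indicator_one hS', measureReal_def, measureReal_def]
      conv_lhs => rw [← hμ.invariant, Measure.map_apply measurable_nextState hS]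
      rfl
    rw [h2]
    refine hasSum_marginal (g := fun k => transProb lam θ B k j) ?_
    have h3 := hi.integral_prod_left
    simp_rw [h1] at h3
    exact h3

end Chain

/-! ### Existence of a stationary regime -/

/-- Law of the state after one cycle. -/
def step (lam θ : ℝ) (B : Measure ℝ) (ν : Measure ZoneState) : Measure ZoneState :=
  (ν.prod (cycleLaw lam θ B)).map fun x => nextState x.1 x.2

/-- Law of the state after `n` cycles from the empty zone, restricted to the event that the zone
has not been empty since. -/
def excursion (lam θ : ℝ) (B : Measure ℝ) : ℕ → Measure ZoneState
  | 0 => Measure.dirac (0, 0)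
  | n + 1 => (step lam θ B (excursion lam θ B n)).restrict {s | s.1 ≠ 0}

theorem measurableSet_fst_ne_zero : MeasurableSet {s : ZoneState | s.1 ≠ 0} :=
  (measurable_fst (measurableSet_singleton 0)).compl

/-- Since unused entries are reset to 0, an empty zone is always the single point `(0, 0)`. This
provides the regeneration state of the age process. -/
theorem eq_zero_of_nextState_fst {s : ZoneState} {ω : Cycle} (h : (nextState s ω).1 = 0) :
    nextState s ω = (0, 0) := by
  refine Prod.ext h (funext fun i => ?_)
  rw [nextState_fst] at h
  simp only [nextState]
  rw [if_neg (by omega), if_neg (by omega)]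
  rfl

theorem nonneg_nextState {s : ZoneState} {ω : Cycle} (hs : ∀ i < s.1, 0 ≤ s.2 i)
    (h1 : 0 < ω.nextArrival) (h2 : 0 < ω.retrialClock) (h3 : 0 ≤ ω.service) :
    ∀ i < (nextState s ω).1, 0 ≤ (nextState s ω).2 i := by
  intro i hi
  rw [nextState_fst] at hi
  simp only [nextState]
  split_ifs with h
  · have h4 : oldIndex s ω i < s.1 := by
      unfold oldIndex
      unfold remaining at h
      split_ifs at h ⊢ <;> simp_all <;> omega
    have := hs _ h4
    have := idleTime_nonneg (s := s) h1 h2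
    positivity
  · have h4 : i - remaining s ω < ω.arrivals := by omega
    exact sub_nonneg.2 (not_lt.1 fun hc => Nat.notMem_of_lt_sInf h4 hc)

/-- Beyond `K` the retrial probability is so near 1 that ρ minus it is at most -(1 - ρ)/2. Below `K`
the choice `M = 2 / a ^ K` makes `M * a ^ k` at least 2, which outweighs ρ + ε < 1. -/
theorem exists_lyapunov {lam θ ρ a : ℝ} (hlam : 0 < lam) (hθ : 0 < θ) (hρ : ρ < 1) (ha : 0 < a)
    (ha1 : a ≤ 1) : ∃ M ε : ℝ, 0 ≤ M ∧ 0 < ε ∧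
      ∀ k : ℕ, ρ - retryProb lam θ k - M * a ^ k + ε ≤ 0 := by
  obtain ⟨K, hK⟩ := exists_nat_ge (2 * lam / ((1 - ρ) * θ))
  have h1 : 0 < 1 - ρ := by linarith
  refine ⟨2 / a ^ K, (1 - ρ) / 2, by positivity, by positivity, fun k => ?_⟩
  have hd := retryProb_nonneg hlam hθ k
  rcases le_total K k with hk | hk
  · have h2 : 1 - retryProb lam θ k ≤ (1 - ρ) / 2 := by
      have h3 := rate_pos hlam hθ k
      rw [one_sub_retryProb hlam hθ, div_le_iff₀ h3]
      have h4 : 2 * lam / ((1 - ρ) * θ) ≤ k := hK.trans (by exact_mod_cast hk)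
      rw [div_le_iff₀ (by positivity)] at h4
      nlinarith
    have h5 : 0 ≤ 2 / a ^ K * a ^ k := by positivity
    linarith
  · have h2 : 2 ≤ 2 / a ^ K * a ^ k := by
      rw [div_mul_eq_mul_div, le_div_iff₀ (by positivity)]
      have := pow_le_pow_of_le_one ha.le ha1 hk
      linarith
    linarith

section Existence

variable {lam θ : ℝ} (hlam : 0 < lam) (hθ : 0 < θ) {B : Measure ℝ} [IsProbabilityMeasure B]
  (hB : ∀ᵐ t ∂B, 0 ≤ t) (hB₂ : Integrable (fun t => t ^ 2) B)

include hlam hθ in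
theorem step_univ (ν : Measure ZoneState) : step lam θ B ν Set.univ = ν Set.univ := by
  have := isProbabilityMeasure_cycleLaw hlam hθ B
  rw [step, Measure.map_apply measurable_nextState .univ, Set.preimage_univ, ← Set.univ_prod_univ,
    Measure.prod_prod, measure_univ (μ := cycleLaw lam θ B), mul_one]

include hlam hθ in
theorem lintegral_step (ν : Measure ZoneState) {f : ZoneState → ℝ≥0∞} (hf : Measurable f) :
    ∫⁻ s, f s ∂step lam θ B ν = ∫⁻ s, ∫⁻ ω, f (nextState s ω) ∂cycleLaw lam θ B ∂ν := by
  have := isProbabilityMeasure_cycleLaw hlam hθ B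
  rw [step, lintegral_map hf measurable_nextState]
  exact lintegral_prod _ (hf.comp measurable_nextState).aemeasurable

include hlam hθ in
theorem step_sum (ν : ℕ → Measure ZoneState) :
    step lam θ B (Measure.sum ν) = Measure.sum fun n => step lam θ B (ν n) := by
  have := isProbabilityMeasure_cycleLaw hlam hθ B
  rw [step, Measure.prod_sum_left, Measure.map_sum measurable_nextState.aemeasurable]
  rfl

omit [IsProbabilityMeasure B] in
theorem step_restrict_eq_dirac (ν : Measure ZoneState) :
    (step lam θ B ν).restrict {s | s.1 ≠ 0}ᶜ
      = step lam θ B ν {s | s.1 ≠ 0}ᶜ • Measure.dirac (0, 0) := by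
  ext E hE
  have h0 := measurableSet_fst_ne_zero.compl
  rw [Measure.restrict_apply hE, Measure.smul_apply, Measure.dirac_apply' _ hE, smul_eq_mul, step,
    Measure.map_apply measurable_nextState (hE.inter h0), Measure.map_apply measurable_nextState h0]
  by_cases h : ((0, 0) : ZoneState) ∈ E
  · rw [Set.indicator_of_mem h, Pi.one_apply, mul_one]
    congr 1
    ext x
    simp only [Set.mem_preimage, Set.mem_inter_iff, and_iff_right_iff_imp]
    intro hx
    rwa [eq_zero_of_nextState_fst (not_not.1 hx)]
  · rw [Set.indicator_of_notMem h, mul_zero, ← measure_empty (μ := ν.prod (cycleLaw lam θ B))]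
    congr 1
    ext x
    refine iff_of_false (fun hx => h ?_) (Set.notMem_empty x)
    have h1 : nextState x.1 x.2 ∈ E := hx.1
    rwa [eq_zero_of_nextState_fst (not_not.1 hx.2)] at h1

include hlam hθ hB hB₂ in
-- Foster's criterion with V(k) = k + M(1 - a^k). The linear part alone may drift upwards for small
-- `k`. The bounded correction repairs this: E a^(N') ≥ 2a^k lowers its mean by at least M a^k, so
-- the drift is at most -ε at every nonempty state.
theorem exists_lintegral_drift (hρ : lam * ∫ t, t ∂B < 1) :
    ∃ (V : ℕ → ℝ≥0∞) (ε : ℝ≥0∞), ε ≠ 0 ∧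
      (∀ s, ∫⁻ ω, V (nextState s ω).1 ∂cycleLaw lam θ B ≠ ∞) ∧
      ∀ s : ZoneState, s.1 ≠ 0 → ∫⁻ ω, V (nextState s ω).1 ∂cycleLaw lam θ B + ε ≤ V s.1 := by
  have := isProbabilityMeasure_cycleLaw hlam hθ B
  obtain ⟨hA, hA'⟩ := integrable_arrivals_and_integral hlam hθ hB hB₂
  have hq : 0 < arrivalProb lam B 0 := arrivalProb_zero_pos hlam hB
  have hq1 : arrivalProb lam B 0 ≤ 1 := by
    rw [← cycleLaw_real_arrivals_eq hlam hθ B hB]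
    exact measureReal_le_one
  have hδ : ∀ k : ℕ, 1 ≤ k → θ / (lam + θ) ≤ retryProb lam θ k := by
    intro k hk
    have hk' : (1 : ℝ) ≤ k := by exact_mod_cast hk
    rw [retryProb, div_le_div_iff₀ (by positivity) (by positivity)]
    nlinarith [mul_nonneg (mul_nonneg hθ.le hlam.le) (sub_nonneg.2 hk')]
  -- From `k ≥ 1`, a retrial without arrivals leads to `k - 1` with probability at least `2 * a`;
  -- θ/(λ + θ) is the least retrial probability over `k ≥ 1`.
  set a := θ / (lam + θ) * arrivalProb lam B 0 / 2 with ha_def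
  have ha : 0 < a := by positivity
  have hη : θ / (lam + θ) ≤ 1 := (div_le_one (by positivity)).2 (by linarith)
  have ha1 : a ≤ 1 := by
    have := mul_le_one₀ hη hq.le hq1
    linarith
  obtain ⟨M, ε, hM, hε, hMε⟩ := exists_lyapunov hlam hθ hρ ha ha1
  have hpow : ∀ k : ℕ, a ^ k ≤ 1 := fun k => pow_le_one₀ ha.le ha1
  have hpow0 : ∀ k : ℕ, 0 < a ^ k := fun k => pow_pos ha k
  have hV0 : ∀ k : ℕ, 0 ≤ k + M * (1 - a ^ k) := fun k => by
    have := hpow k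
    have : 0 ≤ M * (1 - a ^ k) := mul_nonneg hM (by linarith)
    positivity
  have hN : ∀ s, Measurable fun ω => (nextState s ω).1 := fun s =>
    measurable_fst.comp (measurable_nextState.comp measurable_prodMk_left)
  have hfi : ∀ s, Integrable (fun ω => ((nextState s ω).1 : ℝ)) (cycleLaw lam θ B) := fun s => by
    simp_rw [nextState_fst_cast]
    exact ((integrable_const _).sub' (integrable_retryInd hlam hθ B s)).fun_add hA
  have hpi : ∀ s, Integrable (fun ω => a ^ (nextState s ω).1) (cycleLaw lam θ B) := fun s => by
    refine Integrable.of_bound (C := 1) ?_ (ae_of_all _ fun ω => ?_)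
    · exact ((measurable_from_nat (f := fun k : ℕ => a ^ k)).comp (hN s)).aestronglyMeasurable
    · rw [Real.norm_of_nonneg (hpow0 _).le]
      exact hpow _
  have hVi : ∀ s, Integrable (fun ω => ((nextState s ω).1 : ℝ) + M * (1 - a ^ (nextState s ω).1))
      (cycleLaw lam θ B) := fun s =>
    (hfi s).fun_add (((integrable_const _).sub' (hpi s)).const_mul M)
  have hlint : ∀ s, ∫⁻ ω, ENNReal.ofReal
      (((nextState s ω).1 : ℝ) + M * (1 - a ^ (nextState s ω).1)) ∂cycleLaw lam θ B
      = ENNReal.ofReal (∫ ω, (((nextState s ω).1 : ℝ) + M * (1 - a ^ (nextState s ω).1))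
        ∂cycleLaw lam θ B) := fun s =>
    (ofReal_integral_eq_lintegral_ofReal (hVi s) (ae_of_all _ fun ω => hV0 _)).symm
  refine ⟨fun k => ENNReal.ofReal (k + M * (1 - a ^ k)), ENNReal.ofReal ε,
    (ENNReal.ofReal_pos.2 hε).ne', fun s => ?_, fun s hs => ?_⟩
  · rw [hlint]
    exact ENNReal.ofReal_ne_top
  · rw [hlint, ← ENNReal.ofReal_add (integral_nonneg fun ω => hV0 _) hε.le]
    refine ENNReal.ofReal_le_ofReal ?_
    have e1 : ∫ ω, ((nextState s ω).1 : ℝ) ∂cycleLaw lam θ B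
        = s.1 - retryProb lam θ s.1 + lam * ∫ t, t ∂B := by
      simp_rw [nextState_fst_cast]
      rw [integral_add ((integrable_const _).sub' (integrable_retryInd hlam hθ B s)) hA,
        integral_sub (integrable_const _) (integrable_retryInd hlam hθ B s),
        integral_retryInd hlam hθ B, hA']
      simp
    obtain ⟨m, hm⟩ := Nat.exists_eq_add_one_of_ne_zero hs
    have hS : MeasurableSet {x : ℝ × (ℕ → ℝ) | arrivalCount x.1 x.2 = 0} :=
      measurable_arrivalCount (measurableSet_singleton 0)
    have e2 : 2 * a ^ s.1 ≤ ∫ ω, a ^ (nextState s ω).1 ∂cycleLaw lam θ B := by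
      let h : ℝ × (ℕ → ℝ) → ℝ := {x | arrivalCount x.1 x.2 = 0}.indicator 1
      have hh : Measurable h := measurable_one.indicator hS
      have hh' : ∫ ω : Cycle, h ω.2.2.2 ∂cycleLaw lam θ B = arrivalProb lam B 0 := by
        have hS0 : MeasurableSet {ω : Cycle | ω.arrivals = 0} :=
          measurable_arrivals (measurableSet_singleton 0)
        rw [← cycleLaw_real_arrivals_eq hlam hθ B hB, ← integral_indicator_one hS0]
        rfl
      have h1 := integral_retryInd_mul hlam hθ B s hh
      have hb : ∀ ω : Cycle, 0 ≤ retryInd s ω * h ω.2.2.2 * a ^ m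
          ∧ retryInd s ω * h ω.2.2.2 * a ^ m ≤ a ^ (nextState s ω).1 := by
        intro ω
        have h2 := nextState_fst s ω
        by_cases hr : Retries s ω
        · by_cases h0 : ω.arrivals = 0
          · have h3 : h ω.2.2.2 = 1 := Set.indicator_of_mem
              (show ω.2.2.2 ∈ {x : ℝ × (ℕ → ℝ) | arrivalCount x.1 x.2 = 0} from h0) _
            have h4 : (nextState s ω).1 = m := by rw [h2, h0]; simp [remaining, hr, hm]
            rw [h3, h4, retryInd, if_pos hr]
            simp [(hpow0 m).le]
          · have h3 : h ω.2.2.2 = 0 := Set.indicator_of_notMem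
              (show ω.2.2.2 ∉ {x : ℝ × (ℕ → ℝ) | arrivalCount x.1 x.2 = 0} from h0) _
            rw [h3]
            simp [(hpow0 _).le]
        · rw [retryInd, if_neg hr]
          simp [(hpow0 _).le]
      have h5 : ∫ ω : Cycle, retryInd s ω * h ω.2.2.2 * a ^ m ∂cycleLaw lam θ B
          ≤ ∫ ω, a ^ (nextState s ω).1 ∂cycleLaw lam θ B :=
        integral_mono_of_nonneg (ae_of_all _ fun ω => (hb ω).1) (hpi s)
          (ae_of_all _ fun ω => (hb ω).2)
      rw [integral_mul_const, h1, hh'] at h5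
      refine le_trans ?_ h5
      rw [hm, pow_succ]
      have h6 := mul_le_mul_of_nonneg_right (mul_le_mul_of_nonneg_right
        (hδ (m + 1) (by omega)) hq.le) (hpow0 m).le
      have h7 : 2 * (a ^ m * a) = θ / (lam + θ) * arrivalProb lam B 0 * a ^ m := by
        rw [ha_def]; ring
      rw [h7]
      exact h6
    have e3 : ∫ ω, (((nextState s ω).1 : ℝ) + M * (1 - a ^ (nextState s ω).1)) ∂cycleLaw lam θ B
        = s.1 - retryProb lam θ s.1 + lam * (∫ t, t ∂B)
          + M * (1 - ∫ ω, a ^ (nextState s ω).1 ∂cycleLaw lam θ B) := by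
      rw [integral_add (hfi s) (((integrable_const _).sub' (hpi s)).const_mul M),
        integral_const_mul, integral_sub (integrable_const _) (hpi s), e1]
      simp
    have e4 := hMε s.1
    have e5 := mul_le_mul_of_nonneg_left e2 hM
    rw [e3]
    linarith

include hlam hθ hB hB₂ in
-- The mass at time `n` is the probability of no return to the empty state so far, so the total mass
-- is the mean return time. Each further step costs ε times the surviving mass out of a finite
-- initial budget.
theorem sum_excursion_univ_ne_top (hρ : lam * ∫ t, t ∂B < 1) :
    Measure.sum (excursion lam θ B) Set.univ ≠ ∞ := by
  have := isProbabilityMeasure_cycleLaw hlam hθ B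
  obtain ⟨V, ε, hε, hfin, hdrift⟩ := exists_lintegral_drift hlam hθ hB hB₂ hρ
  have hVm : Measurable fun s : ZoneState => V s.1 := measurable_from_nat.comp measurable_fst
  -- The index starts at 1 because the drift inequality fails to cover the empty starting state.
  let m : ℕ → ℝ≥0∞ := fun n => excursion lam θ B (n + 1) Set.univ
  let v : ℕ → ℝ≥0∞ := fun n => ∫⁻ s, V s.1 ∂excursion lam θ B (n + 1)
  have hle : ∀ n, ∫⁻ s, V s.1 ∂excursion lam θ B (n + 1)
      ≤ ∫⁻ s, ∫⁻ ω, V (nextState s ω).1 ∂cycleLaw lam θ B ∂excursion lam θ B n := by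
    intro n
    rw [← lintegral_step hlam hθ _ hVm]
    exact lintegral_mono' Measure.restrict_le_self le_rfl
  have hv0 : v 0 ≠ ∞ := by
    refine ne_top_of_le_ne_top (hfin (0, 0)) ((hle 0).trans (le_of_eq ?_))
    exact lintegral_dirac' _ (Measurable.lintegral_prod_right'
      (f := fun x : ZoneState × Cycle => V (nextState x.1 x.2).1)
      (hVm.comp measurable_nextState))
  have hstep : ∀ n, v (n + 1) + ε * m n ≤ v n := by
    intro n
    have h1 : ∀ᵐ s ∂excursion lam θ B (n + 1), s.1 ≠ 0 :=
      ae_restrict_mem measurableSet_fst_ne_zero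
    calc v (n + 1) + ε * m n
        ≤ ∫⁻ s, ∫⁻ ω, V (nextState s ω).1 ∂cycleLaw lam θ B ∂excursion lam θ B (n + 1)
          + ∫⁻ _, ε ∂excursion lam θ B (n + 1) := by
          rw [lintegral_const]
          gcongr
          exact hle (n + 1)
      _ = ∫⁻ s, (∫⁻ ω, V (nextState s ω).1 ∂cycleLaw lam θ B + ε) ∂excursion lam θ B (n + 1) :=
          (lintegral_add_right _ measurable_const).symm
      _ ≤ v n := lintegral_mono_ae (h1.mono fun s hs => hdrift s hs)
  have hsum : ∀ n, v n + ε * ∑ i ∈ Finset.range n, m i ≤ v 0 := by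
    intro n
    induction n with
    | zero => simp
    | succ n ih =>
      refine le_trans ?_ ih
      rw [Finset.sum_range_succ, mul_add, add_comm (ε * _), ← add_assoc]
      gcongr
      exact hstep n
  have htsum : ε * ∑' i, m i ≤ v 0 := by
    rw [ENNReal.tsum_eq_iSup_nat, ENNReal.mul_iSup]
    exact iSup_le fun n => le_add_self.trans (hsum n)
  rw [Measure.sum_apply _ .univ, tsum_eq_zero_add' ENNReal.summable]
  refine ENNReal.add_ne_top.2 ⟨by simp [excursion], fun h => ?_⟩
  have h2 : ∑' i, m i = ∞ := h
  rw [h2, ENNReal.mul_top hε] at htsum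
  exact hv0 (top_le_iff.1 htsum)

include hlam hθ hB hB₂ in
-- One step turns the excursion measure ν into ν without its initial unit mass, plus whatever
-- returns to the empty state. As a step preserves the finite total mass, the returning mass is
-- exactly 1, and it sits at `(0, 0)`.
theorem step_sum_excursion (hρ : lam * ∫ t, t ∂B < 1) :
    step lam θ B (Measure.sum (excursion lam θ B)) = Measure.sum (excursion lam θ B) := by
  have hfin := sum_excursion_univ_ne_top hlam hθ hB hB₂ hρ
  set ν := Measure.sum (excursion lam θ B) with hν
  have hsplit : ν = Measure.dirac (0, 0) + (step lam θ B ν).restrict {s | s.1 ≠ 0} := by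
    rw [hν, step_sum hlam hθ, Measure.restrict_sum _ measurableSet_fst_ne_zero]
    ext E hE
    rw [Measure.add_apply, Measure.sum_apply _ hE, Measure.sum_apply _ hE,
      tsum_eq_zero_add' ENNReal.summable]
    rfl
  have hmass : step lam θ B ν {s | s.1 ≠ 0}ᶜ = 1 := by
    have h1 := congrArg (fun ν => ν Set.univ) hsplit
    simp only [Measure.add_apply, measure_univ, Measure.restrict_apply_univ] at h1
    have h2 := measure_add_measure_compl (μ := step lam θ B ν) measurableSet_fst_ne_zero
    rw [step_univ hlam hθ, h1, add_comm] at h2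
    refine (ENNReal.add_left_inj ?_).1 h2
    exact ne_top_of_le_ne_top hfin ((measure_mono (Set.subset_univ _)).trans
      (step_univ hlam hθ ν).le)
  have h := Measure.restrict_add_restrict_compl (μ := step lam θ B ν) measurableSet_fst_ne_zero
  rw [step_restrict_eq_dirac, hmass, one_smul, add_comm] at h
  exact h.symm.trans hsplit.symm

include hlam hθ hB in
theorem ae_nonneg_excursion (n : ℕ) :
    ∀ᵐ s ∂excursion lam θ B n, ∀ i < s.1, 0 ≤ s.2 i := by
  have hm : MeasurableSet {s : ZoneState | ∀ i < s.1, 0 ≤ s.2 i} := by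
    simp only [Set.ofPred_forall]
    refine MeasurableSet.iInter fun i => ?_
    have h : {s : ZoneState | i < s.1 → 0 ≤ s.2 i}
        = {s | i < s.1}ᶜ ∪ {s | 0 ≤ s.2 i} := by
      ext s
      simp [imp_iff_not_or]
    have h2 : MeasurableSet {s : ZoneState | i < s.1 → 0 ≤ s.2 i} := by
      rw [h]
      exact (measurableSet_lt measurable_const measurable_fst).compl.union
        (measurableSet_le measurable_const (by fun_prop))
    simpa [Set.ofPred_forall] using h2
  have := isProbabilityMeasure_cycleLaw hlam hθ B
  induction n with
  | zero => simp [excursion, ae_dirac_eq]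
  | succ n ih =>
    refine ae_restrict_of_ae ?_
    rw [step, ae_map_iff measurable_nextState.aemeasurable hm]
    filter_upwards [Measure.quasiMeasurePreserving_fst.ae ih,
      Measure.quasiMeasurePreserving_snd.ae (ae_cycle hlam hθ B hB)] with x hx hω
    exact nonneg_nextState hx hω.1 hω.2.1 hω.2.2.2.1

include hlam hθ hB hB₂ in
theorem exists_isStationaryZoneLaw (hρ : lam * ∫ t, t ∂B < 1) :
    ∃ μ, IsStationaryZoneLaw lam θ B μ := by
  have := isProbabilityMeasure_cycleLaw hlam hθ B
  have hfin := sum_excursion_univ_ne_top hlam hθ hB hB₂ hρ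
  have hinv := step_sum_excursion hlam hθ hB hB₂ hρ
  have hne : Measure.sum (excursion lam θ B) Set.univ ≠ 0 := by
    rw [Measure.sum_apply _ .univ, tsum_eq_zero_add' ENNReal.summable]
    simp [excursion]
  refine ⟨(Measure.sum (excursion lam θ B) Set.univ)⁻¹ • Measure.sum (excursion lam θ B),
    ⟨?_⟩, ?_, ?_⟩
  · rw [Measure.smul_apply, smul_eq_mul, ENNReal.inv_mul_cancel hne hfin]
  · exact Measure.ae_smul_measure (Measure.ae_sum_iff.2 (ae_nonneg_excursion hlam hθ hB)) _
  · rw [Measure.prod_smul_left, Measure.map_smul]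
    congr 1

end Existence

end RetrialQueue

/-! ### The main theorem. -/

theorem mainTheorem1 (lam θ β₁ β₂ ρ : ℝ) (hlam : 0 < lam) (hθ : 0 < θ)
    (B : Measure ℝ) [IsProbabilityMeasure B] (hB : ∀ᵐ t ∂B, 0 ≤ t)
    (hB₂ : Integrable (fun t => t ^ 2) B)
    (hβ₁ : β₁ = ∫ t, t ∂B) (hβ₂ : β₂ = ∫ t, t ^ 2 ∂B)
    (hρ : ρ = lam * β₁) (hρ1 : ρ < 1) :
    ∃ p : ℕ → ℝ,
      RetrialQueue.IsStationaryLaw lam θ B p ∧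
      (∀ p', RetrialQueue.IsStationaryLaw lam θ B p' → p' = p) ∧
      HasSum (fun k : ℕ => (k : ℝ) * p k)
        (ρ + lam * ρ / (θ * (1 - ρ)) + lam ^ 2 * β₂ / (2 * (1 - ρ))) ∧
      (∃ μ, RetrialQueue.IsStationaryZoneLaw lam θ B μ) ∧
      ∀ μ, RetrialQueue.IsStationaryZoneLaw lam θ B μ →
        (∀ k, μ.real {s | s.1 = k} = p k) ∧
        Integrable (fun x : RetrialQueue.ZoneState × RetrialQueue.Cycle =>
            RetrialQueue.sojournTime x.1 x.2) (μ.prod (RetrialQueue.cycleLaw lam θ B)) ∧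
        ∫ x, RetrialQueue.sojournTime x.1 x.2 ∂(μ.prod (RetrialQueue.cycleLaw lam θ B)) =
          β₁ + lam * β₂ / (2 * (1 - ρ)) + ρ / (θ * (1 - ρ)) := by
  subst hρ hβ₁ hβ₂
  obtain ⟨μ, hμ⟩ := RetrialQueue.exists_isStationaryZoneLaw hlam hθ hB hB₂ hρ1
  have hp := hμ.isStationaryLaw hlam hθ hB
  refine ⟨_, hp, fun p' hp' => hp.unique hlam hθ hB hp', ?_, ⟨μ, hμ⟩, fun μ' hμ' => ⟨fun k => ?_,
    RetrialQueue.integral_sojournTime hlam hθ hB hB₂ hμ' hρ1⟩⟩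
  · have h := RetrialQueue.hasSum_marginal (g := fun k => (k : ℝ))
      (RetrialQueue.integrable_waiting hlam hθ hB hB₂ hμ hρ1)
    rw [RetrialQueue.integral_waiting hlam hθ hB hB₂ hμ hρ1] at h
    exact h.congr_fun fun k => mul_comm _ _
  -- The stationary law of the zone may differ from the one that produced `p`, but its marginal is
  -- stationary for the embedded chain, where uniqueness holds.
  · exact congrFun (hp.unique hlam hθ hB (hμ'.isStationaryLaw hlam hθ hB)) k
end
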